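/- Let $0<p<\infty$. For an integer $n\ge 2$ let $\Delta_p^n=\{t\in[0,\infty)^n:\sum_{j=1}^n t_j^p=1\}$, let $\lambda$ be the Lebesgue measure on $\mathbb R^n$, and let $\mu_p$ be the normalized cone measure on $\Delta_p^n$, that is, $\mu_p(A)=\lambda([0,1]\cdot A)/\lambda([0,1]\cdot\Delta_p^n)$ for Borel sets $A\subset\Delta_p^n$. For $\beta>-1$ let $\theta_{p,\beta}$ be the probability measure on $\Delta_p^n$ with $$\frac{d\theta_{p,\beta}}{d\mu_p}(x)=c_{p,\beta}^{-1}\prod_{i=1}^n x_i^\beta,\qquad c_{p,\beta}=\int_{\Delta_p^n}\prod_{i=1}^n x_i^\beta\,d\mu_p(x).$$ For $0\le m\le n-1$ and a Borel probability measure $\mu$ on $\Delta_p^n$ put $\sigma_m^{p,\infty}(\mu)=\int_{\Delta_p^n}\sigma_m(x)_\infty\,d\mu(x)$, where $\sigma_m(x)_\infty=\inf\{\max_j|x_j-y_j| : y\in\mathbb R^n \text{ has at most } m \text{ non-zero coordinates}\}$ (so that $\sigma_{m-1}(x)_\infty$ is the $m$-th largest of the numbers $|x_1|,\dots,|x_n|$).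 There are positive real numbers $C_p^1$ and $C_p^2$, depending only on $p$, such that for all integers $n\ge 2$ and $1\le m\le n$ $$\sigma_{m-1}^{p,\infty}(\theta_{p,p/n-1})\ge C_p^1\cdot\frac{\Gamma(n+1)}{\Gamma(n-m+1)}\cdot\frac{\Gamma(n/p+n-m+1)}{\Gamma(n/p+n+1)}$$ and $$\sigma_{m-1}^{p,\infty}(\theta_{p,p/n-1})\le C_p^2\cdot\frac{\Gamma(n+1)}{\Gamma(n-m+1)}\left\{\frac{\Gamma(n/p+n-m+1)}{\Gamma(n/p+n+1)}+\frac1{m!}\left(\frac{e^{-1}}{\Gamma(1/n)}\right)^m\right\},$$ and such that for every fixed integer $m\ge 1$ $$\frac{C_p^1}{\left(\frac1p+1\right)^m}\le\liminf_{n\to\infty}\sigma_{m-1}^{p,\infty}(\theta_{p,p/n-1})\le\limsup_{n\to\infty}\sigma_{m-1}^{p,\infty}(\theta_{p,p/n-1})\le\frac{C_p^2}{\left(\frac1p+1\right)^m}.$$ -/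

import Mathlib

open MeasureTheory Filter Topology
open scoped ENNReal Pointwise

noncomputable section

namespace SparseAverage

/-- The positive part `{t ∈ ℝ₊ⁿ : ∑ tⱼ ^ p = 1}` of the unit sphere of `ℓ_p^n`, for `0 < p < ∞`. -/
def posSphere (p : ℝ) (n : ℕ) : Set (Fin n → ℝ) :=
  {t | (∀ j, 0 ≤ t j) ∧ ∑ j, t j ^ p = 1}

/-- The vectors of `ℝⁿ` with at most `m` non-zero coordinates. -/
def sparseVectors (n m : ℕ) : Set (Fin n → ℝ) :=
  {y | (Function.support y).ncard ≤ m}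

/-- The best `m`-term approximation error `σ_m(x)_q = inf {‖x - y‖_q : y has at most m non-zero
coordinates}`.  The norm on `PiLp q` is `(∑ |xⱼ| ^ q) ^ (1 / q)` for `0 < q < ∞` and `max |xⱼ|` for
`q = ∞`. -/
def bestTermError (q : ℝ≥0∞) {n : ℕ} (m : ℕ) (x : Fin n → ℝ) : ℝ :=
  ⨅ y : sparseVectors n m, ‖(WithLp.toLp q (x - (y : Fin n → ℝ)) : PiLp q (fun _ : Fin n => ℝ))‖

/-- The average surface best `m`-term width `σ_m^{p,q}(μ)` of `id : ℓ_p^n → ℓ_q^n` with respect to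
a Borel measure `μ`. -/
def averageWidth (p : ℝ) (q : ℝ≥0∞) {n : ℕ} (m : ℕ) (μ : Measure (Fin n → ℝ)) : ℝ :=
  ∫ x in posSphere p n, bestTermError q m x ∂μ

/-- The (quasi-)norm `‖x‖_p` of `ℓ_p^n`, for `0 < p < ∞`. -/
def ellNorm (p : ℝ) {n : ℕ} (x : Fin n → ℝ) : ℝ :=
  (∑ j, |x j| ^ p) ^ (1 / p)

/-- The radial projection `x ↦ x / ‖x‖_p`. -/
def radialProj (p : ℝ) {n : ℕ} (x : Fin n → ℝ) : Fin n → ℝ :=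
  (ellNorm p x)⁻¹ • x

/-- The normalized cone measure on `posSphere p n`: the image, under the radial projection, of the
normalized Lebesgue measure on `[0, 1] · posSphere p n`.  By `coneMeasure_apply` below it is the
measure `A ↦ λ([0, 1] · A) / λ([0, 1] · posSphere p n)`. -/
def coneMeasure (p : ℝ) (n : ℕ) : Measure (Fin n → ℝ) :=
  (volume (Set.Icc (0 : ℝ) 1 • posSphere p n))⁻¹ •
    (volume.restrict (Set.Icc (0 : ℝ) 1 • posSphere p n)).map (radialProj p)

/-- The normalizing constant `∫ ∏ xᵢ ^ β dμ_p`. -/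
def tensorConst (p β : ℝ) (n : ℕ) : ℝ≥0∞ :=
  ∫⁻ x in posSphere p n, ENNReal.ofReal (∏ i, x i ^ β) ∂(coneMeasure p n)

/-- The measure `θ_{p,β}` with density `c⁻¹ ∏ xᵢ ^ β` with respect to the cone measure.  (For
`β < 0` the density matters only where no coordinate vanishes, that is, almost everywhere.) -/
def tensorMeasure (p β : ℝ) (n : ℕ) : Measure (Fin n → ℝ) :=
  (coneMeasure p n).withDensity fun x => (tensorConst p β n)⁻¹ * ENNReal.ofReal (∏ i, x i ^ β)

theorem measurable_radialProj (p : ℝ) (n : ℕ) :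
    Measurable (radialProj p : (Fin n → ℝ) → (Fin n → ℝ)) := by
  unfold radialProj ellNorm
  fun_prop

theorem radialProj_smul {p : ℝ} (hp : 0 < p) {n : ℕ} {r : ℝ} (hr : 0 < r) {t : Fin n → ℝ}
    (ht : t ∈ posSphere p n) : radialProj p (r • t) = t := by
  have h : ellNorm p (r • t) = r := by
    have h1 : ∀ j, |(r • t) j| ^ p = r ^ p * t j ^ p := fun j => by
      have hj := ht.1 j
      rw [Pi.smul_apply, smul_eq_mul, abs_of_nonneg (by positivity), Real.mul_rpow hr.le hj]
    rw [ellNorm, Finset.sum_congr rfl fun j _ => h1 j, ← Finset.mul_sum, ht.2, mul_one,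
      ← Real.rpow_mul hr.le, mul_one_div_cancel hp.ne', Real.rpow_one]
  rw [radialProj, h, smul_smul, inv_mul_cancel₀ hr.ne', one_smul]

theorem zero_notMem_posSphere {p : ℝ} (hp : 0 < p) (n : ℕ) : (0 : Fin n → ℝ) ∉ posSphere p n := by
  rintro ⟨-, h⟩
  simp [Real.zero_rpow hp.ne'] at h

/-- The defining formula of the normalized cone measure. -/
theorem coneMeasure_apply {p : ℝ} (hp : 0 < p) {n : ℕ} (hn : 1 ≤ n) {A : Set (Fin n → ℝ)}
    (hA : MeasurableSet A) (hAs : A ⊆ posSphere p n) :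
    coneMeasure p n A =
      volume (Set.Icc (0 : ℝ) 1 • A) / volume (Set.Icc (0 : ℝ) 1 • posSphere p n) := by
  have : Nonempty (Fin n) := ⟨⟨0, hn⟩⟩
  have hm := measurable_radialProj p n
  rw [coneMeasure, Measure.smul_apply, Measure.map_apply hm hA, Measure.restrict_apply (hm hA),
    smul_eq_mul, ENNReal.div_eq_inv_mul]
  congr 1
  apply le_antisymm
  · apply measure_mono
    rintro x ⟨hx, r, hr, t, ht, rfl⟩
    rcases hr.1.eq_or_lt with h0 | h0
    · subst h0
      exact absurd (hAs hx) (by simpa [radialProj] using zero_notMem_posSphere hp n)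
    · refine ⟨r, hr, t, ?_, rfl⟩
      simpa [radialProj_smul hp h0 ht] using hx
  · have hsub : Set.Icc (0 : ℝ) 1 • A ⊆
        (radialProj p ⁻¹' A ∩ Set.Icc (0 : ℝ) 1 • posSphere p n) ∪ {0} := by
      rintro x ⟨r, hr, t, ht, rfl⟩
      rcases hr.1.eq_or_lt with h0 | h0
      · subst h0
        right
        simp
      · left
        refine ⟨?_, r, hr, t, hAs ht, rfl⟩
        simpa [radialProj_smul hp h0 (hAs ht)] using ht
    calc volume (Set.Icc (0 : ℝ) 1 • A) ≤ _ := measure_mono hsub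
      _ ≤ _ + volume ({0} : Set (Fin n → ℝ)) := measure_union_le _ _
      _ = _ := by simp

end SparseAverage

end

/-! Let X have independent coordinates with density proportional to t^(p/n-1) exp(-t^p) on (0, ∞).
The shapes 1/n of the Gamma variables X_i^p add up to 1, so ‖X‖_p^p is exponential, and X/‖X‖_p is
independent of it with law θ_{p,p/n-1}. For f homogeneous of degree one this gives E f(X) = Γ(1/p+1)
∫ f dθ, which is `lintegral_tensorMeasure`. Its proof uses no independence, only a polar formula
whose angular constants cancel.

For f the best (m-1)-term error, f(X) > t means that at least m coordinates exceed t. The layer-cake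
formula therefore turns E f(X) into the integral over t > 0 of a binomial tail at F(t), the common
distribution function (`meanError_eq`). If F(t) were (κt)^(p/n), the coordinates would be κ⁻¹
U^(n/p) with U uniform, and the integral would be κ⁻¹ times the (n/p)-th moment of a uniform order
statistic, which is exactly the quotient of Gamma functions in the theorem
(`lintegral_binomTail_scaled`).

The true F is compared with such powers: F(t) ≤ t^(p/n)/Γ(1+1/n) for all t > 0, and F(t) ≥ F(1)
t^(p/n) for t ≤ 1. After rescaling, the constants enter only through Γ(1+1/n)^n ≥ 1/π and F(1)^n ≥
1/4, uniformly in n. The range t ≥ 1 in the upper bound is handled by a union bound and the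
exponential tail of the density, which produces the second summand. For fixed m the Gamma quotient
tends to (1/p+1)^(-m), and the second contribution is bounded by a constant multiple of that limit.
-/

namespace SparseAverage

open Set

/-! ### Polar coordinates for a homogeneous gauge, and integrals of products. -/

/-- Rescaling a radial integral. -/
theorem lintegral_Ioi_comp_mul_right {c : ℝ} (hc : 0 < c) (k : ℕ) (φ : ℝ → ℝ≥0∞) :
    ∫⁻ r in Ioi (0 : ℝ), ENNReal.ofReal (r ^ k) * φ (r * c) =
      ENNReal.ofReal (c⁻¹ ^ (k + 1)) *
        ∫⁻ s in Ioi (0 : ℝ), ENNReal.ofReal (s ^ k) * φ s := by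
  have hci : 0 < c⁻¹ := inv_pos.2 hc
  have hemb : MeasurableEmbedding (fun s : ℝ => c⁻¹ * s) :=
    (Homeomorph.mulLeft₀ c⁻¹ hci.ne').measurableEmbedding
  rw [← lintegral_indicator measurableSet_Ioi, ← lintegral_indicator measurableSet_Ioi,
    ← lintegral_const_mul' _ _ ENNReal.ofReal_ne_top]
  -- The substitution r = c⁻¹s, expressed as the scaling of Lebesgue measure under this map.
  conv_lhs => rw [← Real.smul_map_volume_mul_left hci.ne']
  rw [lintegral_smul_measure, hemb.lintegral_map, smul_eq_mul,
    ← lintegral_const_mul' _ _ ENNReal.ofReal_ne_top]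
  congr 1
  ext s
  by_cases hs : 0 < s
  · rw [indicator_of_mem (mem_Ioi.2 (mul_pos hci hs)), indicator_of_mem (mem_Ioi.2 hs),
      abs_of_pos hci, ← mul_assoc, ← mul_assoc, ← ENNReal.ofReal_mul hci.le,
      ← ENNReal.ofReal_mul (by positivity)]
    congr 2
    · ring
    · field_simp
  · have : ¬ 0 < c⁻¹ * s := fun h => hs (pos_of_mul_pos_right h hci.le)
    rw [indicator_of_notMem (by simpa using this), indicator_of_notMem (by simpa using hs)]
    simp

/-- Integration in polar coordinates with respect to an arbitrary positively homogeneous gauge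
`N`. -/
theorem exists_lintegral_homogeneous {E : Type*} [NormedAddCommGroup E] [NormedSpace ℝ E]
    [FiniteDimensional ℝ E] [Nontrivial E] [MeasurableSpace E] [BorelSpace E]
    (μ : Measure E) [μ.IsAddHaarMeasure]
    {h : E → ℝ≥0∞} (hm : Measurable h) (hh : ∀ r : ℝ, 0 < r → ∀ x, h (r • x) = h x)
    {N : E → ℝ} (hNm : Measurable N) (hN : ∀ r : ℝ, 0 < r → ∀ x, N (r • x) = r * N x)
    (hN0 : ∀ x, x ≠ 0 → 0 < N x) :
    ∃ A : ℝ≥0∞, ∀ φ : ℝ → ℝ≥0∞, Measurable φ → ∫⁻ x, h x * φ (N x) ∂μ =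
      A * ∫⁻ s in Ioi (0 : ℝ),
        ENNReal.ofReal (s ^ (Module.finrank ℝ E - 1)) * φ s := by
  -- On the ray through u, substituting s = r N(u) produces N(u)^(-d) with d the dimension. The
  -- constant does not depend on φ, so different radial profiles can be compared through it.
  refine ⟨∫⁻ u : Metric.sphere (0 : E) 1, h u *
    ENNReal.ofReal ((N u)⁻¹ ^ (Module.finrank ℝ E - 1 + 1)) ∂μ.toSphere, fun φ hφ => ?_⟩
  have hS : ∀ u : Metric.sphere (0 : E) 1, 0 < N u := fun u => hN0 _ (by
    have := u.2
    rintro h0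
    simp [h0] at this)
  calc ∫⁻ x, h x * φ (N x) ∂μ
      = ∫⁻ x : ({(0)}ᶜ : Set E), h x * φ (N x) ∂(μ.comap (↑)) := by
        rw [lintegral_subtype_comap (measurableSet_singleton _).compl fun x => h x * φ (N x),
          restrict_compl_singleton]
    _ = ∫⁻ z, h z.1 * φ (z.2 * N z.1)
          ∂μ.toSphere.prod (.volumeIoiPow (Module.finrank ℝ E - 1)) := by
        rw [← μ.measurePreserving_homeomorphUnitSphereProd.lintegral_comp_emb
          (Homeomorph.measurableEmbedding _)]
        congr 1
        ext x
        have hx : 0 < ‖(x : E)‖ := norm_pos_iff.2 x.2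
        simp only [homeomorphUnitSphereProd_apply_fst_coe, homeomorphUnitSphereProd_apply_snd_coe]
        rw [hN _ (inv_pos.2 hx), hh _ (inv_pos.2 hx), mul_inv_cancel_left₀ hx.ne']
    _ = ∫⁻ u : Metric.sphere (0 : E) 1, h u * (∫⁻ r in Ioi (0 : ℝ),
          ENNReal.ofReal (r ^ (Module.finrank ℝ E - 1)) * φ (r * N u)) ∂μ.toSphere := by
        rw [lintegral_prod _ (by fun_prop)]
        congr 1
        ext u
        dsimp only
        rw [lintegral_const_mul _ (by fun_prop), Measure.volumeIoiPow,
          lintegral_withDensity_eq_lintegral_mul _ (by fun_prop) (by fun_prop),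
          ← lintegral_subtype_comap measurableSet_Ioi]
        rfl
    _ = _ := by
        rw [← lintegral_mul_const _ (by fun_prop)]
        congr 1
        ext u
        rw [lintegral_Ioi_comp_mul_right (hS u), mul_assoc]

/-- The integral of a product function over `ℝⁿ`. -/
theorem lintegral_prod_apply {n : ℕ} (μ : Measure ℝ) [SigmaFinite μ] (f : Fin n → ℝ → ℝ≥0∞)
    (hf : ∀ i, Measurable (f i)) :
    ∫⁻ x, ∏ i, f i (x i) ∂(Measure.pi fun _ : Fin n => μ) = ∏ i, ∫⁻ t, f i t ∂μ := by
  induction n with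
  | zero => simp
  | succ n ih =>
    have hmp := (measurePreserving_piFinSuccAbove (fun _ : Fin (n + 1) => μ) 0).symm
    rw [← hmp.lintegral_comp_emb (MeasurableEquiv.measurableEmbedding _),
      Fin.prod_univ_succ, ← ih _ fun i => hf _,
      ← lintegral_prod_mul (hf 0).aemeasurable (by
        exact (Finset.measurable_fun_prod _ fun i _ =>
          (hf (Fin.succ i)).comp (measurable_pi_apply i)).aemeasurable)]
    congr 1
    ext z
    rw [Fin.prod_univ_succ]
    simp

/-! ### The best m-term error in ℓ_∞, and densities of product measures. -/

theorem bestTermError_top_nonneg {n : ℕ} (m : ℕ) (x : Fin n → ℝ) : 0 ≤ bestTermError ∞ m x :=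
  Real.iInf_nonneg fun _ => norm_nonneg _

/-- The best `m`-term error in `ℓ_∞` exceeds `t` exactly when more than `m` coordinates exceed
`t` in absolute value. -/
theorem lt_bestTermError_top_iff {n m : ℕ} {x : Fin n → ℝ} {t : ℝ} (ht : 0 ≤ t) :
    t < bestTermError ∞ m x ↔ m < (Finset.univ.filter fun i => t < |x i|).card := by
  have hbdd : BddBelow (range fun y : sparseVectors n m =>
      ‖(WithLp.toLp ∞ (x - (y : Fin n → ℝ)) : PiLp ∞ (fun _ : Fin n => ℝ))‖) :=
    ⟨0, by rintro _ ⟨y, rfl⟩; exact norm_nonneg _⟩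
  constructor
  · intro h
    by_contra! hc
    -- Keeping exactly the large coordinates leaves an error of at most t.
    let y : Fin n → ℝ := fun i => if t < |x i| then x i else 0
    have hy : y ∈ sparseVectors n m := by
      refine le_trans ?_ hc
      rw [← Set.ncard_coe_finset]
      refine Set.ncard_le_ncard ?_ (Finset.finite_toSet _)
      intro i hi
      by_contra hi'
      exact hi (if_neg (by simpa using hi'))
    refine absurd (ciInf_le hbdd ⟨y, hy⟩) (not_le.2 (lt_of_le_of_lt ?_ h))
    rw [PiLp.norm_toLp, pi_norm_le_iff_of_nonneg ht]
    intro i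
    by_cases hi : t < |x i|
    · simpa [y, hi] using ht
    · simpa [y, if_neg hi] using not_lt.1 hi
  · intro h
    set s := Finset.univ.filter fun i => t < |x i| with hs
    have hne : s.Nonempty := Finset.card_pos.1 (by omega)
    -- Every competitor y misses some large coordinate. The smallest large one bounds the error
    -- below uniformly in y, so the strict inequality survives the infimum.
    obtain ⟨j, hj, hmin⟩ := s.exists_min_image (fun i => |x i|) hne
    refine lt_of_lt_of_le (show t < |x j| by simpa [hs] using hj) ?_
    have : Nonempty (sparseVectors n m) := ⟨0, by simp [sparseVectors]⟩
    refine le_ciInf fun y => ?_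
    have : ∃ i ∈ s, (y : Fin n → ℝ) i = 0 := by
      by_contra! hc
      have h1 : s.card ≤ (Function.support (y : Fin n → ℝ)).ncard := by
        rw [← Set.ncard_coe_finset]
        exact Set.ncard_le_ncard (fun i hi => hc i hi) (Set.toFinite _)
      have h2 : (Function.support (y : Fin n → ℝ)).ncard ≤ m := y.2
      omega
    obtain ⟨i, hi, hyi⟩ := this
    refine (hmin i hi).trans ?_
    rw [PiLp.norm_toLp]
    simpa [hyi] using norm_le_pi_norm (x - (y : Fin n → ℝ)) i

theorem measurable_bestTermError_top {n : ℕ} (m : ℕ) :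
    Measurable (bestTermError ∞ m : (Fin n → ℝ) → ℝ) := by
  refine measurable_of_Ioi fun t => ?_
  rcases lt_or_ge t 0 with ht | ht
  · convert MeasurableSet.univ
    exact eq_univ_of_forall fun x => ht.trans_le (bestTermError_top_nonneg _ _)
  · have : bestTermError ∞ m ⁻¹' Ioi t =
        ⋃ s ∈ {s : Finset (Fin n) | m < s.card}, {x : Fin n → ℝ | ∀ i ∈ s, t < |x i|} := by
      ext x
      simp only [mem_preimage, mem_Ioi, lt_bestTermError_top_iff ht, mem_iUnion, mem_ofPred_eq,
        exists_prop]
      constructor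
      · exact fun h => ⟨_, h, by simp⟩
      · rintro ⟨s, hs, hx⟩
        exact hs.trans_le (Finset.card_le_card fun i hi => by simpa using hx i hi)
    rw [this]
    refine MeasurableSet.biUnion (Set.to_countable _) fun s _ => ?_
    simp only [ofPred_forall]
    exact MeasurableSet.iInter fun i => MeasurableSet.iInter fun _ =>
      measurableSet_lt measurable_const (by fun_prop)

theorem bestTermError_top_smul {n : ℕ} (m : ℕ) {r : ℝ} (hr : 0 < r) (x : Fin n → ℝ) :
    bestTermError ∞ m (r • x) = r * bestTermError ∞ m x := by
  -- Two nonnegative numbers that exceed the same t ≥ 0 are equal, so homogeneity reduces to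
  -- counting coordinates.
  have key : ∀ t : ℝ, 0 ≤ t →
      (t < bestTermError ∞ m (r • x) ↔ t < r * bestTermError ∞ m x) := by
    intro t ht
    rw [lt_bestTermError_top_iff ht, ← div_lt_iff₀' hr, lt_bestTermError_top_iff (by positivity)]
    simp [abs_mul, abs_of_pos hr, div_lt_iff₀' hr]
  have h1 := bestTermError_top_nonneg m (r • x)
  have h2 := mul_nonneg hr.le (bestTermError_top_nonneg m x)
  apply le_antisymm
  · by_contra! h
    exact lt_irrefl _ ((key _ h2).1 h)
  · by_contra! h
    exact lt_irrefl _ ((key _ h1).2 h)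

theorem pi_withDensity {n : ℕ} (μ : Measure ℝ) [SigmaFinite μ] {f : ℝ → ℝ≥0∞} (hf : Measurable f)
    [SigmaFinite (μ.withDensity f)] :
    (Measure.pi fun _ : Fin n => μ.withDensity f) =
      (Measure.pi fun _ : Fin n => μ).withDensity fun x => ∏ i, f (x i) := by
  refine Measure.pi_eq fun s hs => ?_
  rw [withDensity_apply _ (MeasurableSet.univ_pi hs), Measure.restrict_pi_pi]
  have : ∀ i, SigmaFinite (μ.restrict (s i)) := fun i => inferInstance
  rw [← Measure.restrict_pi_pi, ← lintegral_indicator (MeasurableSet.univ_pi hs)]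
  have h : ((univ.pi s).indicator fun x : Fin n → ℝ => ∏ i, f (x i)) =
      fun x => ∏ i, (s i).indicator f (x i) := by
    ext x
    by_cases hx : x ∈ univ.pi s
    · rw [indicator_of_mem hx]
      exact Finset.prod_congr rfl fun i _ => (indicator_of_mem (hx i trivial) _).symm
    · rw [indicator_of_notMem hx]
      obtain ⟨i, hi⟩ : ∃ i, x i ∉ s i := by simpa [mem_univ_pi] using hx
      exact (Finset.prod_eq_zero (Finset.mem_univ i) (indicator_of_notMem hi _)).symm
  rw [h, lintegral_prod_apply μ _ fun i => hf.indicator (hs i)]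
  exact Finset.prod_congr rfl fun i _ => by
    rw [lintegral_indicator (hs i), withDensity_apply _ (hs i)]

/-! ### The ℓ_p gauge, the positive orthant and the cone measure. -/

section Gauge

variable {p : ℝ} {n : ℕ}

theorem measurable_ellNorm (p : ℝ) (n : ℕ) : Measurable (ellNorm p : (Fin n → ℝ) → ℝ) := by
  unfold ellNorm
  fun_prop

theorem ellNorm_nonneg (x : Fin n → ℝ) : 0 ≤ ellNorm p x := by
  unfold ellNorm
  positivity

theorem ellNorm_rpow (hp : 0 < p) (x : Fin n → ℝ) : ellNorm p x ^ p = ∑ i, |x i| ^ p := by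
  rw [ellNorm, ← Real.rpow_mul (by positivity), one_div_mul_cancel hp.ne', Real.rpow_one]

theorem ellNorm_smul (hp : 0 < p) {r : ℝ} (hr : 0 < r) (x : Fin n → ℝ) :
    ellNorm p (r • x) = r * ellNorm p x := by
  have h : ∀ j, |(r • x) j| ^ p = r ^ p * |x j| ^ p := fun j => by
    rw [Pi.smul_apply, smul_eq_mul, abs_mul, abs_of_pos hr, Real.mul_rpow hr.le (abs_nonneg _)]
  rw [ellNorm, Finset.sum_congr rfl fun j _ => h j, ← Finset.mul_sum,
    Real.mul_rpow (by positivity) (by positivity), ← Real.rpow_mul hr.le,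
    mul_one_div_cancel hp.ne', Real.rpow_one, ellNorm]

theorem ellNorm_pos {x : Fin n → ℝ} (hx : x ≠ 0) : 0 < ellNorm p x := by
  obtain ⟨i, hi⟩ := Function.ne_iff.1 hx
  have : 0 < |x i| := abs_pos.2 hi
  unfold ellNorm
  refine Real.rpow_pos_of_pos (Finset.sum_pos' (fun _ _ => by positivity)
    ⟨i, Finset.mem_univ _, by positivity⟩) _

theorem ellNorm_eq_one {t : Fin n → ℝ} (ht : t ∈ posSphere p n) :
    ellNorm p t = 1 := by
  rw [ellNorm, Finset.sum_congr rfl fun j _ => by rw [abs_of_nonneg (ht.1 j)], ht.2, Real.one_rpow]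

theorem radialProj_smul_eq (hp : 0 < p) {r : ℝ} (hr : 0 < r) (x : Fin n → ℝ) :
    radialProj p (r • x) = radialProj p x := by
  rw [radialProj, ellNorm_smul hp hr, smul_smul, mul_inv_rev, inv_mul_cancel_right₀ hr.ne',
    radialProj]

theorem ellNorm_smul_radialProj {x : Fin n → ℝ} (hx : x ≠ 0) :
    ellNorm p x • radialProj p x = x := by
  rw [radialProj, smul_smul, mul_inv_cancel₀ (ellNorm_pos hx).ne', one_smul]

theorem radialProj_mem_posSphere (hp : 0 < p) {x : Fin n → ℝ} (hx : x ≠ 0) (h0 : ∀ i, 0 ≤ x i) :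
    radialProj p x ∈ posSphere p n := by
  have hN := ellNorm_pos (p := p) hx
  have h1 : ∀ i, 0 ≤ radialProj p x i := fun i => mul_nonneg (inv_nonneg.2 hN.le) (h0 i)
  refine ⟨h1, ?_⟩
  have h2 : ellNorm p (radialProj p x) = 1 := by
    rw [radialProj, ellNorm_smul hp (inv_pos.2 hN), inv_mul_cancel₀ hN.ne']
  have h3 := ellNorm_rpow hp (radialProj p x)
  rw [h2, Real.one_rpow] at h3
  rw [h3]
  exact Finset.sum_congr rfl fun i _ => by rw [abs_of_nonneg (h1 i)]

theorem measurableSet_posSphere (p : ℝ) (n : ℕ) : MeasurableSet (posSphere p n) := by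
  have h1 : MeasurableSet {t : Fin n → ℝ | ∀ j, 0 ≤ t j} := by
    simp only [ofPred_forall]
    exact MeasurableSet.iInter fun j => measurableSet_le measurable_const (by fun_prop)
  exact h1.inter (measurableSet_eq_fun (by fun_prop) measurable_const)

/-- The open positive orthant. -/
def posOrthant (n : ℕ) : Set (Fin n → ℝ) := univ.pi fun _ => Ioi 0

theorem measurableSet_posOrthant (n : ℕ) : MeasurableSet (posOrthant n) :=
  MeasurableSet.univ_pi fun _ => measurableSet_Ioi

theorem ne_zero_of_mem_posOrthant [NeZero n] {x : Fin n → ℝ} (hx : x ∈ posOrthant n) : x ≠ 0 := by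
  rintro rfl
  exact lt_irrefl (0 : ℝ) (hx 0 trivial)

theorem smul_mem_posOrthant_iff {r : ℝ} (hr : 0 < r) {x : Fin n → ℝ} :
    r • x ∈ posOrthant n ↔ x ∈ posOrthant n := by
  simp [posOrthant, hr]

theorem volume_cone_ne_top (hp : 0 < p) (n : ℕ) :
    volume (Icc (0 : ℝ) 1 • posSphere p n) ≠ ∞ := by
  refine ne_top_of_le_ne_top (isCompact_Icc (a := (0 : Fin n → ℝ)) (b := 1)).measure_lt_top.ne
    (measure_mono ?_)
  rintro _ ⟨r, hr, t, ht, rfl⟩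
  have h1 : ∀ i, t i ≤ 1 := fun i => by
    have h : t i ^ p ≤ 1 := ht.2 ▸ Finset.single_le_sum
      (fun j _ => Real.rpow_nonneg (ht.1 j) p) (Finset.mem_univ i)
    by_contra! hc
    exact absurd (Real.one_lt_rpow hc hp) (not_lt.2 h)
  exact ⟨fun i => mul_nonneg hr.1 (ht.1 i), fun i => mul_le_one₀ hr.2 (ht.1 i) (h1 i)⟩

theorem volume_cone_ne_zero (hp : 0 < p) [NeZero n] :
    volume (Icc (0 : ℝ) 1 • posSphere p n) ≠ 0 := by
  have hn : (0 : ℝ) < n := by exact_mod_cast NeZero.pos n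
  -- With nε^p = 1 the open cube (0, ε)^n lies in the unit ball and has positive volume.
  set ε : ℝ := (1 / n : ℝ) ^ (1 / p) with hε
  have hε0 : 0 < ε := by positivity
  have hεp : ε ^ p = 1 / n := by
    rw [hε, ← Real.rpow_mul (by positivity), one_div_mul_cancel hp.ne', Real.rpow_one]
  have hsub : (univ.pi fun _ : Fin n => Ioo 0 ε) ⊆ Icc (0 : ℝ) 1 • posSphere p n := by
    intro x hx
    have hx0 : x ≠ 0 := ne_zero_of_mem_posOrthant fun i _ => (hx i trivial).1
    refine ⟨ellNorm p x, ⟨ellNorm_nonneg _, ?_⟩, _,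
      radialProj_mem_posSphere hp hx0 fun i => (hx i trivial).1.le, ellNorm_smul_radialProj hx0⟩
    refine Real.rpow_le_one (by positivity) ?_ (by positivity)
    calc ∑ i, |x i| ^ p ≤ ∑ _i : Fin n, ε ^ p := Finset.sum_le_sum fun i _ => by
          rw [abs_of_pos (hx i trivial).1]
          exact Real.rpow_le_rpow (hx i trivial).1.le (hx i trivial).2.le hp.le
      _ = 1 := by
          rw [Finset.sum_const, Finset.card_univ, Fintype.card_fin, hεp, nsmul_eq_mul,
            mul_one_div_cancel hn.ne']
  refine ne_of_gt (lt_of_lt_of_le ?_ (measure_mono hsub))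
  rw [Real.volume_pi_Ioo]
  exact CanonicallyOrderedAdd.prod_pos.2 fun i _ => by simpa using hε0

/-- Integration against the cone measure, as a Lebesgue integral over the positive part of the
unit ball. -/
theorem setLIntegral_coneMeasure (hp : 0 < p) [NeZero n] {g : (Fin n → ℝ) → ℝ≥0∞}
    (hg : Measurable g) :
    ∫⁻ x in posSphere p n, g x ∂coneMeasure p n =
      (volume (Icc (0 : ℝ) 1 • posSphere p n))⁻¹ *
        ∫⁻ x, (posOrthant n).indicator (fun x => g (radialProj p x)) x *
          (Iic (1 : ℝ)).indicator 1 (ellNorm p x) := by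
  have hm := measurable_radialProj p n
  rw [coneMeasure, Measure.restrict_smul, lintegral_smul_measure,
    setLIntegral_map (measurableSet_posSphere p n) hg hm, smul_eq_mul,
    Measure.restrict_restrict (hm (measurableSet_posSphere p n))]
  congr 1
  -- The two sets differ only at points with a vanishing coordinate, a null set.
  have hae : (radialProj p ⁻¹' posSphere p n ∩ Icc (0 : ℝ) 1 • posSphere p n : Set (Fin n → ℝ))
      =ᵐ[volume] (posOrthant n ∩ ellNorm p ⁻¹' Iic 1 : Set (Fin n → ℝ)) := by
    have h0 : ∀ᵐ x : Fin n → ℝ, ∀ i, x i ≠ 0 :=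
      ae_all_iff.2 fun i => Measure.ae_eval_ne (fun _ : Fin n => (volume : Measure ℝ)) i 0
    filter_upwards [h0] with x hx
    refine propext ⟨?_, ?_⟩
    · rintro ⟨-, r, hr, t, ht, rfl⟩
      have hr0 : 0 < r := lt_of_le_of_ne hr.1 fun h => hx 0 (by simp [← h])
      refine ⟨fun i _ => lt_of_le_of_ne (mul_nonneg hr.1 (ht.1 i)) (hx i).symm, ?_⟩
      change ellNorm p (r • t) ≤ 1
      rw [ellNorm_smul hp hr0, ellNorm_eq_one ht, mul_one]
      exact hr.2
    · rintro ⟨h1, h2⟩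
      have hx0 := ne_zero_of_mem_posOrthant h1
      have h3 := radialProj_mem_posSphere hp hx0 fun i => (h1 i trivial).le
      exact ⟨h3, ellNorm p x, ⟨ellNorm_nonneg _, h2⟩, _, h3, ellNorm_smul_radialProj hx0⟩
  rw [setLIntegral_congr hae, ← lintegral_indicator
    ((measurableSet_posOrthant n).inter (measurable_ellNorm p n measurableSet_Iic))]
  congr 1
  ext x
  by_cases h1 : x ∈ posOrthant n <;> by_cases h2 : ellNorm p x ≤ 1 <;> simp [h1, h2]

end Gauge

/-! ### Representation of θ_{p,p/n-1} by independent coordinates. -/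

section Representation

variable {p : ℝ} {n : ℕ}

/-- The unnormalized density `t ^ (p / n - 1) * exp (-t ^ p)` on `(0, ∞)`. -/
noncomputable def coordWeight (p : ℝ) (n : ℕ) : ℝ → ℝ≥0∞ :=
  (Ioi 0).indicator fun t => ENNReal.ofReal (t ^ (p / n - 1) * Real.exp (-t ^ p))

theorem measurable_coordWeight (p : ℝ) (n : ℕ) : Measurable (coordWeight p n) :=
  Measurable.indicator (by fun_prop) measurableSet_Ioi

theorem lintegral_rpow_mul_exp (hp : 0 < p) {q : ℝ} (hq : -1 < q) :
    ∫⁻ t in Ioi (0 : ℝ), ENNReal.ofReal (t ^ q * Real.exp (-t ^ p)) =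
      ENNReal.ofReal (1 / p * Real.Gamma ((q + 1) / p)) := by
  have h := integral_rpow_mul_exp_neg_rpow hp hq
  have hpos : 0 < 1 / p * Real.Gamma ((q + 1) / p) :=
    mul_pos (by positivity) (Real.Gamma_pos_of_pos (div_pos (by linarith) hp))
  have hint : IntegrableOn (fun t : ℝ => t ^ q * Real.exp (-t ^ p)) (Ioi 0) := by
    by_contra hc
    rw [integral_undef hc] at h
    exact hpos.ne h
  rw [← h, ofReal_integral_eq_lintegral_ofReal hint]
  exact (ae_restrict_iff' measurableSet_Ioi).2 (ae_of_all _ fun t ht => by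
    have : (0 : ℝ) < t := ht
    positivity)

/-- The law of `G ^ (1 / p)`, where `G` has the Gamma distribution with shape parameter `1 / n`. -/
noncomputable def coordLaw (p : ℝ) (n : ℕ) : Measure ℝ :=
  volume.withDensity fun t => ENNReal.ofReal (p / Real.Gamma (1 / n)) * coordWeight p n t

theorem lintegral_coordWeight (hp : 0 < p) [NeZero n] :
    ∫⁻ t, coordWeight p n t = ENNReal.ofReal (Real.Gamma (1 / n) / p) := by
  have hn : (0 : ℝ) < n := by exact_mod_cast NeZero.pos n
  have : -1 < p / n - 1 := by linarith [div_pos hp hn]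
  rw [coordWeight, lintegral_indicator measurableSet_Ioi, lintegral_rpow_mul_exp hp this]
  congr 1
  rw [sub_add_cancel, div_right_comm, div_self hp.ne', one_div_mul_eq_div]

theorem Gamma_one_div_pos (n : ℕ) [NeZero n] : 0 < Real.Gamma (1 / n) := by
  have hn : (0 : ℝ) < n := by exact_mod_cast NeZero.pos n
  exact Real.Gamma_pos_of_pos (by positivity)

theorem isProbabilityMeasure_coordLaw (hp : 0 < p) [NeZero n] :
    IsProbabilityMeasure (coordLaw p n) := by
  have hG := Gamma_one_div_pos n
  constructor
  rw [coordLaw, withDensity_apply _ MeasurableSet.univ, setLIntegral_univ,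
    lintegral_const_mul _ (measurable_coordWeight p n), lintegral_coordWeight hp,
    ← ENNReal.ofReal_mul (by positivity), div_mul_div_comm, mul_comm, div_self (by positivity),
    ENNReal.ofReal_one]

theorem lintegral_pi_coordLaw (hp : 0 < p) [NeZero n] {f : (Fin n → ℝ) → ℝ≥0∞}
    (hf : Measurable f) :
    ∫⁻ x, f x ∂(Measure.pi fun _ : Fin n => coordLaw p n) =
      ENNReal.ofReal (p / Real.Gamma (1 / n)) ^ n *
        ∫⁻ x, (∏ i, coordWeight p n (x i)) * f x := by
  have := isProbabilityMeasure_coordLaw (n := n) hp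
  have hw := measurable_coordWeight p n
  have hsf : SigmaFinite ((volume : Measure ℝ).withDensity fun t =>
    ENNReal.ofReal (p / Real.Gamma (1 / n)) * coordWeight p n t) := by
    change SigmaFinite (coordLaw p n)
    infer_instance
  rw [coordLaw, pi_withDensity _ (hw.const_mul _), lintegral_withDensity_eq_lintegral_mul _ _ hf,
    ← lintegral_const_mul' _ _ (by finiteness)]
  · simp [volume_pi, Finset.prod_mul_distrib, mul_assoc]
  · exact Finset.measurable_fun_prod _ fun i _ => (hw.const_mul _).comp (measurable_pi_apply i)

/-- The product density of the coordinate weights, in terms of the cone decomposition. -/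
theorem prod_coordWeight (hp : 0 < p) [NeZero n] (x : Fin n → ℝ) :
    ∏ i, coordWeight p n (x i) = (posOrthant n).indicator
      (fun x => ENNReal.ofReal (∏ i, radialProj p x i ^ (p / n - 1))) x *
        ENNReal.ofReal (ellNorm p x ^ (p - n) * Real.exp (-ellNorm p x ^ p)) := by
  by_cases hx : x ∈ posOrthant n
  · have hx0 := ne_zero_of_mem_posOrthant hx
    have hN := ellNorm_pos (p := p) hx0
    have hpos : ∀ i, 0 < x i := fun i => hx i trivial
    have hrp : ∀ i, 0 < radialProj p x i := fun i => mul_pos (inv_pos.2 hN) (hpos i)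
    have hn : (n : ℝ) ≠ 0 := by exact_mod_cast NeZero.ne n
    rw [indicator_of_mem hx, ← ENNReal.ofReal_mul (Finset.prod_nonneg fun i _ => by
      have := hrp i; positivity)]
    simp_rw [coordWeight]
    rw [Finset.prod_congr rfl fun i _ => indicator_of_mem (mem_Ioi.2 (hpos i)) _,
      ← ENNReal.ofReal_prod_of_nonneg fun i _ => by have := hpos i; positivity]
    congr 1
    have h0 : ∑ i, |x i| ^ p = ∑ i, x i ^ p :=
      Finset.sum_congr rfl fun i _ => by rw [abs_of_pos (hpos i)]
    rw [Finset.prod_mul_distrib, ← Real.exp_sum, ellNorm_rpow hp, Finset.sum_neg_distrib, h0,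
      ← mul_assoc]
    congr 1
    -- The product of the powers is homogeneous of degree n(p/n-1) = p-n, which is the radial
    -- exponent.
    have h1 : ∀ i, x i ^ (p / n - 1) =
        ellNorm p x ^ (p / n - 1) * radialProj p x i ^ (p / n - 1) := fun i => by
      rw [← Real.mul_rpow hN.le (hrp i).le]
      congr 1
      exact (congrFun (ellNorm_smul_radialProj hx0) i).symm
    rw [Finset.prod_congr rfl fun i _ => h1 i, Finset.prod_mul_distrib, Finset.prod_const,
      Finset.card_univ, Fintype.card_fin, ← Real.rpow_mul_natCast hN.le, mul_comm]
    congr 2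
    field_simp
  · rw [indicator_of_notMem hx, zero_mul]
    obtain ⟨i, hi⟩ : ∃ i, x i ∉ Ioi (0 : ℝ) := by simpa [posOrthant, mem_univ_pi] using hx
    exact Finset.prod_eq_zero (Finset.mem_univ i) (indicator_of_notMem hi _)

/-- Polar decomposition of the integral of a degree-one homogeneous function against
`θ_{p,p/n-1}`: up to a constant it is the mean of the function over independent coordinates. -/
theorem lintegral_tensorMeasure (hp : 0 < p) [NeZero n] {f : (Fin n → ℝ) → ℝ} (hf : Measurable f)
    (hhom : ∀ r : ℝ, 0 < r → ∀ x, f (r • x) = r * f x) :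
    ∫⁻ x in posSphere p n, ENNReal.ofReal (f x) ∂tensorMeasure p (p / n - 1) n =
      ENNReal.ofReal (1 / Real.Gamma (1 / p + 1)) *
        ∫⁻ x, ENNReal.ofReal (f x) ∂(Measure.pi fun _ : Fin n => coordLaw p n) := by
  have hn0 : 0 < n := NeZero.pos n
  have hn : (0 : ℝ) < n := by exact_mod_cast hn0
  have : Nonempty (Fin n) := ⟨0⟩
  set P : (Fin n → ℝ) → ℝ≥0∞ := fun x => ENNReal.ofReal (∏ i, x i ^ (p / n - 1)) with hP
  have hPm : Measurable P := by
    refine ENNReal.measurable_ofReal.comp (Finset.measurable_fun_prod _ fun i _ => by fun_prop)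
  have hrm := measurable_radialProj p n
  set V := volume (Icc (0 : ℝ) 1 • posSphere p n) with hV
  have hVt : V ≠ ∞ := volume_cone_ne_top hp n
  have hpolar : ∀ g : (Fin n → ℝ) → ℝ≥0∞, Measurable g → ∃ A : ℝ≥0∞,
      ∀ φ : ℝ → ℝ≥0∞, Measurable φ →
        ∫⁻ x, (posOrthant n).indicator (fun x => g (radialProj p x)) x * φ (ellNorm p x) =
          A * ∫⁻ s in Ioi (0 : ℝ), ENNReal.ofReal (s ^ (n - 1)) * φ s := by
    intro g hg
    have h := exists_lintegral_homogeneous (volume : Measure (Fin n → ℝ))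
      (h := (posOrthant n).indicator fun x => g (radialProj p x)) (N := ellNorm p)
      ((hg.comp hrm).indicator (measurableSet_posOrthant n))
      (fun r hr x => by
        by_cases hx : x ∈ posOrthant n
        · rw [indicator_of_mem hx, indicator_of_mem ((smul_mem_posOrthant_iff hr).2 hx),
            radialProj_smul_eq hp hr]
        · rw [indicator_of_notMem hx,
            indicator_of_notMem (fun h => hx ((smul_mem_posOrthant_iff hr).1 h))])
      (measurable_ellNorm p n) (fun r hr x => ellNorm_smul hp hr x) fun x hx => ellNorm_pos hx
    simpa using h
  -- `A₁` and `A₂` are the angular integrals of the density and of the density times f. Only the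
  -- ratio A₁⁻¹A₂ enters the integral against θ.
  obtain ⟨A₁, hA₁⟩ := hpolar P hPm
  obtain ⟨A₂, hA₂⟩ := hpolar (fun x => P x * ENNReal.ofReal (f x)) (by fun_prop)
  set M := ∫⁻ s in Ioi (0 : ℝ), ENNReal.ofReal (s ^ (n - 1)) * (Iic (1 : ℝ)).indicator 1 s with hM
  have hind : Measurable ((Iic (1 : ℝ)).indicator (1 : ℝ → ℝ≥0∞)) :=
    measurable_one.indicator measurableSet_Iic
  have hc : tensorConst p (p / n - 1) n = V⁻¹ * (A₁ * M) := by
    rw [tensorConst, setLIntegral_coneMeasure hp hPm, hA₁ _ hind]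
  have hnum : ∫⁻ x in posSphere p n, ENNReal.ofReal (f x) ∂tensorMeasure p (p / n - 1) n =
      (V⁻¹ * (A₁ * M))⁻¹ * (V⁻¹ * (A₂ * M)) := by
    rw [tensorMeasure, restrict_withDensity (measurableSet_posSphere p n),
      lintegral_withDensity_eq_lintegral_mul _ (by fun_prop) (by fun_prop), ← hA₂ _ hind,
      ← setLIntegral_coneMeasure (g := fun x => P x * ENNReal.ofReal (f x)) hp (by fun_prop),
      ← hc, ← lintegral_const_mul _ (by fun_prop)]
    simp [hP, mul_assoc]
  have hpow : ∀ (q : ℝ) (s : ℝ), 0 < s → ENNReal.ofReal (s ^ (n - 1)) *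
      ENNReal.ofReal (s ^ q * Real.exp (-s ^ p)) =
      ENNReal.ofReal (s ^ (q + n - 1) * Real.exp (-s ^ p)) := fun q s hs => by
    rw [← ENNReal.ofReal_mul (by positivity), ← mul_assoc, ← Real.rpow_natCast,
      ← Real.rpow_add hs, Nat.cast_sub hn0]
    congr 3
    push_cast
    ring
  -- The total radial weight is s^(p-n) s^(n-1) exp(-s^p) = s^(p-1) exp(-s^p), of mass 1/p: this is
  -- the exponential law of the p-th power of the norm.
  have hJ₁ : ENNReal.ofReal (Real.Gamma (1 / n) / p) ^ n = A₁ * ENNReal.ofReal (1 / p) := by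
    have h1 : ∫⁻ x : Fin n → ℝ, ∏ i, coordWeight p n (x i) =
        ENNReal.ofReal (Real.Gamma (1 / n) / p) ^ n := by
      rw [volume_pi, lintegral_prod_apply _ _ fun _ => measurable_coordWeight p n,
        lintegral_coordWeight hp]
      simp
    rw [← h1]
    simp_rw [prod_coordWeight hp]
    rw [hA₁ (fun s => ENNReal.ofReal (s ^ (p - n) * Real.exp (-s ^ p))) (by fun_prop),
      setLIntegral_congr_fun measurableSet_Ioi fun s hs => hpow _ s hs,
      lintegral_rpow_mul_exp hp (by linarith)]
    congr 2
    rw [show (p - n + n - 1 + 1) / p = 1 by field_simp; ring, Real.Gamma_one, mul_one]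
  -- Homogeneity of f contributes one more factor s to the radial integral, hence the extra factor
  -- Γ(1/p+1).
  have hJ₂ : ∫⁻ x : Fin n → ℝ, (∏ i, coordWeight p n (x i)) * ENNReal.ofReal (f x) =
      A₂ * ENNReal.ofReal (1 / p * Real.Gamma (1 / p + 1)) := by
    have h1 : ∀ x : Fin n → ℝ, (∏ i, coordWeight p n (x i)) * ENNReal.ofReal (f x) =
        (posOrthant n).indicator (fun x => P (radialProj p x) *
          ENNReal.ofReal (f (radialProj p x))) x *
        ENNReal.ofReal (ellNorm p x ^ (p - n + 1) * Real.exp (-ellNorm p x ^ p)) := by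
      intro x
      rw [prod_coordWeight hp]
      by_cases hx : x ∈ posOrthant n
      · have hx0 := ne_zero_of_mem_posOrthant hx
        have hN := ellNorm_pos (p := p) hx0
        have hfx : f x = ellNorm p x * f (radialProj p x) := by
          rw [← hhom _ hN, ellNorm_smul_radialProj hx0]
        rw [indicator_of_mem hx, indicator_of_mem hx, hfx, ENNReal.ofReal_mul hN.le,
          Real.rpow_add hN, Real.rpow_one, mul_right_comm _ (ellNorm p x),
          ENNReal.ofReal_mul (q := ellNorm p x) (by positivity)]
        ring
      · simp [indicator_of_notMem hx]
    simp_rw [h1]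
    rw [hA₂ (fun s => ENNReal.ofReal (s ^ (p - n + 1) * Real.exp (-s ^ p))) (by fun_prop),
      setLIntegral_congr_fun measurableSet_Ioi fun s hs => hpow _ s hs,
      lintegral_rpow_mul_exp hp (by linarith)]
    congr 4
    field_simp
    ring
  have hG := Gamma_one_div_pos n
  have hGp : 0 < Real.Gamma (1 / p + 1) := Real.Gamma_pos_of_pos (by positivity)
  have hinv : ENNReal.ofReal (p / Real.Gamma (1 / n)) ^ n = (A₁ * ENNReal.ofReal (1 / p))⁻¹ := by
    rw [← hJ₁, ENNReal.inv_pow, ← ENNReal.ofReal_inv_of_pos (by positivity), inv_div]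
  have hMval : M = ENNReal.ofReal (1 / n) := by
    have h1 : ∀ s : ℝ, ENNReal.ofReal (s ^ (n - 1)) * (Iic (1 : ℝ)).indicator 1 s =
        (Iic (1 : ℝ)).indicator (fun s => ENNReal.ofReal (s ^ (n - 1))) s := fun s => by
      by_cases hs : s ∈ Iic (1 : ℝ) <;> simp [hs]
    simp_rw [hM, h1]
    rw [setLIntegral_indicator measurableSet_Iic, inter_comm, Ioi_inter_Iic,
      ← ofReal_integral_eq_lintegral_ofReal, ← intervalIntegral.integral_of_le zero_le_one,
      integral_pow]
    · simp [Nat.cast_sub hn0]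
    · exact (continuous_pow _).integrableOn_Ioc
    · exact (ae_restrict_iff' measurableSet_Ioc).2 (ae_of_all _ fun t ht => pow_nonneg ht.1.le _)
  have hM0 : M ≠ 0 := by
    rw [hMval]
    simpa using hn0.ne'
  have hMt : M ≠ ∞ := by
    rw [hMval]
    finiteness
  have hV0 : V ≠ 0 := volume_cone_ne_zero hp
  have hcancel : ∀ a b c d : ℝ≥0∞, c ≠ 0 → c ≠ ∞ → d ≠ 0 → d ≠ ∞ →
      (c * (a * d))⁻¹ * (c * (b * d)) = a⁻¹ * b := by
    intro a b c d hc0 hct hd0 hdt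
    rw [← ENNReal.div_eq_inv_mul, ENNReal.mul_div_mul_left _ _ hc0 hct,
      ENNReal.mul_div_mul_right _ _ hd0 hdt, ENNReal.div_eq_inv_mul]
  have hg0 : ENNReal.ofReal (Real.Gamma (1 / p + 1)) ≠ 0 := by simpa using hGp
  have hp0 : ENNReal.ofReal (1 / p) ≠ 0 := by simpa using hp
  rw [hnum, hcancel _ _ _ _ (ENNReal.inv_ne_zero.2 hVt) (ENNReal.inv_ne_top.2 hV0) hM0 hMt,
    lintegral_pi_coordLaw hp (by fun_prop), hinv, hJ₂, one_div (Real.Gamma _),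
    ENNReal.ofReal_inv_of_pos hGp, ENNReal.ofReal_mul (by positivity)]
  have h := hcancel A₁ A₂ 1 _ one_ne_zero ENNReal.one_ne_top hp0 ENNReal.ofReal_ne_top
  rw [one_mul, one_mul] at h
  rw [← h]
  set g := ENNReal.ofReal (Real.Gamma (1 / p + 1)) with hg
  set a := ENNReal.ofReal (1 / p)
  calc (A₁ * a)⁻¹ * (A₂ * a) = (g⁻¹ * g) * ((A₁ * a)⁻¹ * (A₂ * a)) := by
        rw [ENNReal.inv_mul_cancel hg0 ENNReal.ofReal_ne_top, one_mul]
    _ = _ := by ring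

end Representation

/-! ### Binomial tails and moments of uniform order statistics. -/

section BinomialTail

/-- The probability that at least `m` among `n` independent events of probability `1 - q` occur. -/
noncomputable def binomTail (n m : ℕ) (q : ℝ) : ℝ :=
  ∑ k ∈ Finset.Ico m (n + 1), (n.choose k : ℝ) * ((1 - q) ^ k * q ^ (n - k))

variable {n m : ℕ} {q : ℝ}

theorem continuous_binomTail (n m : ℕ) : Continuous (binomTail n m) := by
  unfold binomTail
  fun_prop

theorem binomTail_nonneg (h0 : 0 ≤ q) (h1 : q ≤ 1) : 0 ≤ binomTail n m q := by
  have : 0 ≤ 1 - q := by linarith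
  exact Finset.sum_nonneg fun k _ => by positivity

/-- This is the union bound over the m-element sets of events. Algebraically, C(n,m+j) ≤ C(n,m)
C(n-m,j), and the remaining sum over j is (1-q+q)^(n-m) = 1. -/
theorem binomTail_le (hmn : m ≤ n) (h0 : 0 ≤ q) (h1 : q ≤ 1) :
    binomTail n m q ≤ n.choose m * (1 - q) ^ m := by
  have hq : 0 ≤ 1 - q := by linarith
  have hone : ∑ j ∈ Finset.range (n - m + 1),
      (1 - q) ^ j * q ^ (n - m - j) * ((n - m).choose j : ℝ) = 1 := by
    rw [← add_pow]; simp
  suffices h : binomTail n m q ≤ ∑ j ∈ Finset.range (n - m + 1),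
      n.choose m * (1 - q) ^ m * ((1 - q) ^ j * q ^ (n - m - j) * (n - m).choose j) by
    rwa [← Finset.mul_sum, hone, mul_one] at h
  rw [binomTail, Finset.sum_Ico_eq_sum_range, show n + 1 - m = n - m + 1 by omega]
  refine Finset.sum_le_sum fun j hj => ?_
  have hj' : m + j ≤ n := by have := Finset.mem_range.1 hj; omega
  have hc : (n.choose (m + j) : ℝ) ≤ n.choose m * (n - m).choose j := by
    have h := Nat.choose_mul (n := n) (k := m + j) (s := m) (by omega)
    rw [Nat.add_sub_cancel_left] at h
    have h2 : n.choose (m + j) ≤ n.choose m * (n - m).choose j := by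
      rw [← h]
      exact Nat.le_mul_of_pos_right _ (Nat.choose_pos (by omega))
    exact_mod_cast h2
  calc (n.choose (m + j) : ℝ) * ((1 - q) ^ (m + j) * q ^ (n - (m + j)))
      ≤ (n.choose m * (n - m).choose j) * ((1 - q) ^ (m + j) * q ^ (n - (m + j))) := by gcongr
    _ = n.choose m * (1 - q) ^ m * ((1 - q) ^ j * q ^ (n - m - j) * (n - m).choose j) := by
        rw [pow_add, Nat.sub_sub]; ring

/-- The termwise derivatives telescope, since (k+1) C(n,k+1) = (n-k) C(n,k). Only the lower end
survives: C(n,n+1) = 0 removes the upper one. For m = 0 the truncated exponent m-1 is harmless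
because of the factor m. -/
theorem hasDerivAt_binomTail (hmn : m ≤ n) (q : ℝ) :
    HasDerivAt (binomTail n m) (-(m * n.choose m * ((1 - q) ^ (m - 1) * q ^ (n - m)))) q := by
  set D : ℕ → ℝ := fun k => k * n.choose k * ((1 - q) ^ (k - 1) * q ^ (n - k)) with hD
  have hterm : ∀ k ∈ Finset.Ico m (n + 1),
      HasDerivAt (fun q : ℝ => (n.choose k : ℝ) * ((1 - q) ^ k * q ^ (n - k)))
        (D (k + 1) - D k) q := by
    intro k hk
    have hk := Finset.mem_Ico.1 hk
    have h1 : HasDerivAt (fun q : ℝ => (1 - q) ^ k) (k * (1 - q) ^ (k - 1) * (-1)) q := by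
      exact ((hasDerivAt_id q).const_sub 1).fun_pow k
    have h2 : HasDerivAt (fun q : ℝ => q ^ (n - k)) ((n - k : ℕ) * q ^ (n - k - 1)) q :=
      hasDerivAt_pow _ _
    refine ((h1.mul h2).const_mul _).congr_deriv ?_
    have hc : ((k + 1 : ℕ) : ℝ) * n.choose (k + 1) = n.choose k * (n - k : ℕ) := by
      rw [mul_comm]
      exact_mod_cast Nat.choose_succ_right_eq n k
    simp only [hD]
    rw [hc, Nat.add_sub_cancel, Nat.sub_sub]
    ring
  refine (HasDerivAt.fun_sum hterm).congr_deriv ?_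
  rw [Finset.sum_Ico_sub _ (by omega)]
  simp [hD]

theorem antitoneOn_binomTail (hmn : m ≤ n) :
    AntitoneOn (binomTail n m) (Icc 0 1) := by
  refine antitoneOn_of_deriv_nonpos (convex_Icc 0 1) (continuous_binomTail n m).continuousOn
    (fun q _ => (hasDerivAt_binomTail hmn q).differentiableAt.differentiableWithinAt)
    fun q hq => ?_
  rw [interior_Icc] at hq
  rw [(hasDerivAt_binomTail hmn q).deriv, neg_nonpos]
  have h0 := hq.1.le
  have h1 : 0 ≤ 1 - q := by linarith [hq.2]
  positivity

/-- `n! / (n - m)! * Γ(α + n - m + 1) / Γ(α + n + 1)`: the `α`-th moment of the `m`-th largest of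
`n` independent uniform random variables. -/
noncomputable def orderMoment (n m : ℕ) (α : ℝ) : ℝ :=
  Real.Gamma (n + 1) / Real.Gamma (n - m + 1) *
    (Real.Gamma (α + n - m + 1) / Real.Gamma (α + n + 1))

theorem orderMoment_pos (hmn : m ≤ n) {α : ℝ} (hα : 0 < α) : 0 < orderMoment n m α := by
  have h : (m : ℝ) ≤ n := by exact_mod_cast hmn
  have h1 : 0 < Real.Gamma (n + 1) := Real.Gamma_pos_of_pos (by positivity)
  have h2 : 0 < Real.Gamma (n - m + 1) := Real.Gamma_pos_of_pos (by linarith)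
  have h3 : 0 < Real.Gamma (α + n - m + 1) := Real.Gamma_pos_of_pos (by linarith)
  have h4 : 0 < Real.Gamma (α + n + 1) := Real.Gamma_pos_of_pos (by positivity)
  unfold orderMoment
  positivity

theorem lintegral_beta {a b : ℝ} (ha : 0 < a) (hb : 0 < b) :
    ∫⁻ u in Ioo (0 : ℝ) 1, ENNReal.ofReal (u ^ (a - 1) * (1 - u) ^ (b - 1)) =
      ENNReal.ofReal (Real.Gamma a * Real.Gamma b / Real.Gamma (a + b)) := by
  have h := ProbabilityTheory.lintegral_betaPDF_eq_one ha hb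
  have hB := ProbabilityTheory.beta_pos ha hb
  rw [ProbabilityTheory.lintegral_betaPDF] at h
  have h1 : ∀ x ∈ Ioo (0 : ℝ) 1, ENNReal.ofReal
      (1 / ProbabilityTheory.beta a b * x ^ (a - 1) * (1 - x) ^ (b - 1)) =
      ENNReal.ofReal (1 / ProbabilityTheory.beta a b) *
        ENNReal.ofReal (x ^ (a - 1) * (1 - x) ^ (b - 1)) := fun x _ => by
    rw [mul_assoc, ENNReal.ofReal_mul (by positivity)]
  rw [setLIntegral_congr_fun measurableSet_Ioo h1, lintegral_const_mul' _ _ (by finiteness),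
    one_div, ENNReal.ofReal_inv_of_pos hB] at h
  have h2 := ENNReal.eq_inv_of_mul_eq_one_left (by rwa [mul_comm] at h)
  rw [inv_inv] at h2
  exact h2

/-- The left side is the layer-cake formula for the α-th moment of the m-th largest of n uniform
variables. Descending induction on m starts at m = n, where the tail is a single term. Each step
adds one Beta integral, matched on the right by the functional equation of Γ. -/
theorem lintegral_binomTail_mul {α : ℝ} (hα : 0 < α) (hmn : m ≤ n) :
    ∫⁻ u in Ioo (0 : ℝ) 1, ENNReal.ofReal (α * u ^ (α - 1) * binomTail n m u) =
      ENNReal.ofReal (orderMoment n m α) := by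
  have hG : 0 < Real.Gamma (α + n + 1) := Real.Gamma_pos_of_pos (by positivity)
  have hterm : ∀ k ≤ n, ∫⁻ u in Ioo (0 : ℝ) 1, ENNReal.ofReal
      (α * u ^ (α - 1) * ((n.choose k : ℝ) * ((1 - u) ^ k * u ^ (n - k)))) =
      ENNReal.ofReal (n.factorial / Real.Gamma (α + n + 1) *
        (α * Real.Gamma (α + (n - k : ℕ)) / (n - k).factorial)) := by
    intro k hk
    have h1 : ∀ u ∈ Ioo (0 : ℝ) 1, ENNReal.ofReal
        (α * u ^ (α - 1) * ((n.choose k : ℝ) * ((1 - u) ^ k * u ^ (n - k)))) =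
        ENNReal.ofReal (α * n.choose k) *
          ENNReal.ofReal (u ^ (α + (n - k : ℕ) - 1) * (1 - u) ^ ((k + 1 : ℝ) - 1)) := by
      intro u hu
      rw [← ENNReal.ofReal_mul (by positivity), add_sub_cancel_right, Real.rpow_natCast,
        add_sub_right_comm, Real.rpow_add hu.1, Real.rpow_natCast]
      congr 1
      ring
    rw [setLIntegral_congr_fun measurableSet_Ioo h1, lintegral_const_mul' _ _ (by finiteness),
      lintegral_beta (by positivity) (by positivity), ← ENNReal.ofReal_mul (by positivity)]
    congr 1
    rw [Real.Gamma_nat_eq_factorial, Nat.cast_choose ℝ hk,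
      show α + (n - k : ℕ) + (k + 1 : ℝ) = α + n + 1 by rw [Nat.cast_sub hk]; ring]
    field_simp
  induction hmn using Nat.decreasingInduction with
  | self =>
    have h1 : ∀ u, binomTail n n u = (n.choose n : ℝ) * ((1 - u) ^ n * u ^ (n - n)) := fun u => by
      simp [binomTail]
    simp_rw [h1]
    rw [hterm n le_rfl, orderMoment]
    congr 1
    simp [Real.Gamma_add_one hα.ne', Real.Gamma_nat_eq_factorial]
    ring
  | of_succ k hk ih =>
    have h1 : ∀ u ∈ Ioo (0 : ℝ) 1, ENNReal.ofReal (α * u ^ (α - 1) * binomTail n k u) =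
        ENNReal.ofReal (α * u ^ (α - 1) * ((n.choose k : ℝ) * ((1 - u) ^ k * u ^ (n - k)))) +
        ENNReal.ofReal (α * u ^ (α - 1) * binomTail n (k + 1) u) := by
      intro u hu
      have h0 := hu.1.le
      have h1 : 0 ≤ 1 - u := by linarith [hu.2]
      rw [← ENNReal.ofReal_add (by positivity)
        (mul_nonneg (by positivity) (binomTail_nonneg hu.1.le hu.2.le)), ← mul_add]
      congr 2
      exact Finset.sum_eq_sum_Ico_succ_bot (by omega) _
    have hpos := (orderMoment_pos (m := k + 1) (n := n) hk hα).le
    rw [setLIntegral_congr_fun measurableSet_Ioo h1, lintegral_add_left (by fun_prop), ih,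
      hterm k (by omega), ← ENNReal.ofReal_add _ hpos]
    · congr 1
      obtain ⟨j, rfl⟩ : ∃ j, n = k + 1 + j := ⟨n - (k + 1), by omega⟩
      have e1 : k + 1 + j - k = j + 1 := by omega
      have hj : (0 : ℝ) < α + j + 1 := by positivity
      simp only [orderMoment, e1]
      push_cast
      rw [show (k + 1 + j : ℝ) - (k + 1) + 1 = j + 1 by ring,
        show (k + 1 + j : ℝ) - k + 1 = (j + 1 : ℕ) + 1 by push_cast; ring,
        show α + (k + 1 + j : ℝ) - (k + 1) + 1 = α + j + 1 by ring,
        show α + (k + 1 + j : ℝ) - k + 1 = (α + j + 1) + 1 by ring,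
        show (k + 1 + j : ℝ) + 1 = (k + 1 + j : ℕ) + 1 by push_cast; ring,
        Real.Gamma_add_one hj.ne', Real.Gamma_nat_eq_factorial, Real.Gamma_nat_eq_factorial,
        Real.Gamma_nat_eq_factorial, Nat.factorial_succ j, show α + (j + 1 : ℝ) = α + j + 1 by ring]
      push_cast
      push_cast at hG
      field_simp
      ring
    · have : 0 < Real.Gamma (α + (n - k : ℕ)) := Real.Gamma_pos_of_pos (by positivity)
      positivity

/-- The substitution s = u^α in the previous integral. It is needed because the model distribution
function is a power s^(1/α) with α = n/p. -/
theorem lintegral_binomTail_rpow {α : ℝ} (hα : 0 < α) (hmn : m ≤ n) :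
    ∫⁻ s in Ioo (0 : ℝ) 1, ENNReal.ofReal (binomTail n m (s ^ (1 / α))) =
      ENNReal.ofReal (orderMoment n m α) := by
  have himg : (fun u : ℝ => u ^ α) '' Ioo 0 1 = Ioo 0 1 := by
    ext s
    constructor
    · rintro ⟨u, hu, rfl⟩
      exact ⟨Real.rpow_pos_of_pos hu.1 _, Real.rpow_lt_one hu.1.le hu.2 hα⟩
    · rintro hs
      exact ⟨s ^ (1 / α), ⟨Real.rpow_pos_of_pos hs.1 _,
        Real.rpow_lt_one hs.1.le hs.2 (by positivity)⟩, by
        simp only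
        rw [← Real.rpow_mul hs.1.le, one_div_mul_cancel hα.ne', Real.rpow_one]⟩
  rw [← lintegral_binomTail_mul hα hmn]
  conv_lhs => rw [← himg]
  rw [lintegral_image_eq_lintegral_abs_deriv_mul measurableSet_Ioo
    (f' := fun u : ℝ => α * u ^ (α - 1))
    (fun u hu => (Real.hasDerivAt_rpow_const (.inl hu.1.ne')).hasDerivWithinAt)
    (fun u hu v hv h => (Real.rpow_left_inj hu.1.le hv.1.le hα.ne').1 h)]
  refine setLIntegral_congr_fun measurableSet_Ioo fun u hu => ?_
  have h0 := hu.1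
  rw [abs_of_pos (by positivity), ← ENNReal.ofReal_mul (by positivity), ← Real.rpow_mul hu.1.le,
    mul_one_div_cancel hα.ne', Real.rpow_one]

/-- The law of the number of large coordinates of a vector with independent coordinates. -/
theorem measure_lt_bestTermError_top (ν : Measure ℝ) [IsProbabilityMeasure ν] (n m : ℕ) {t : ℝ}
    (ht : 0 ≤ t) :
    (Measure.pi fun _ : Fin n => ν) {x | t < bestTermError ∞ m x} =
      ENNReal.ofReal (binomTail n (m + 1) (ν.real {s | |s| ≤ t})) := by
  classical
  set q := ν.real {s | |s| ≤ t} with hq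
  set T : Set ℝ := {s | |s| ≤ t} with hT
  have hTm : MeasurableSet T := measurableSet_le (by fun_prop) measurable_const
  -- The boxes partition the space by the exact set S of coordinates larger than t. The probability
  -- of a box depends only on the cardinality of S, and grouping by it gives the binomial sum.
  set box : Finset (Fin n) → Set (Fin n → ℝ) :=
    fun S => univ.pi fun i => if i ∈ S then Tᶜ else T with hbox
  have hmem : ∀ S x, x ∈ box S ↔ (Finset.univ.filter fun i => t < |x i|) = S := by
    intro S x
    simp only [hbox, mem_univ_pi, Finset.ext_iff, Finset.mem_filter, Finset.mem_univ, true_and]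
    refine forall_congr' fun i => ?_
    by_cases hi : i ∈ S <;> simp [hi, hT]
  have hset : {x : Fin n → ℝ | t < bestTermError ∞ m x} =
      ⋃ S ∈ Finset.univ.filter (fun S : Finset (Fin n) => m < S.card), box S := by
    ext x
    simp only [mem_ofPred_eq, lt_bestTermError_top_iff ht, mem_iUnion, hmem, Finset.mem_filter,
      Finset.mem_univ, true_and, exists_prop]
    exact ⟨fun h => ⟨_, h, rfl⟩, by rintro ⟨_, h, rfl⟩; exact h⟩
  have hboxm : ∀ S, MeasurableSet (box S) := fun S => MeasurableSet.univ_pi fun i => by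
    split_ifs
    exacts [hTm.compl, hTm]
  have hq1 : q ≤ 1 := measureReal_le_one
  have hq0 : 0 ≤ q := measureReal_nonneg
  have hq' : 0 ≤ 1 - q := by linarith
  have hval : ∀ S, (Measure.pi fun _ : Fin n => ν) (box S) =
      ENNReal.ofReal ((1 - q) ^ S.card * q ^ (n - S.card)) := by
    intro S
    have h1 : ν T = ENNReal.ofReal q := by rw [hq, ofReal_measureReal]
    have h2 : ν Tᶜ = ENNReal.ofReal (1 - q) := by
      rw [hq, ← probReal_compl_eq_one_sub hTm, ofReal_measureReal]
    rw [Measure.pi_pi, ENNReal.ofReal_mul (by positivity), ENNReal.ofReal_pow hq',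
      ENNReal.ofReal_pow hq0, ← h1, ← h2]
    simp_rw [apply_ite ν]
    rw [Finset.prod_ite, Finset.prod_const, Finset.prod_const]
    congr 2
    · simp
    · rw [Finset.filter_not, Finset.card_sdiff_of_subset (by simp)]
      simp
  rw [hset, measure_biUnion_finset _ fun S _ => hboxm S, Finset.sum_congr rfl fun S _ => hval S,
    ← ENNReal.ofReal_sum_of_nonneg fun S _ => by positivity]
  · congr 1
    rw [Finset.sum_filter, ← Finset.powerset_univ, Finset.sum_powerset_apply_card
      (fun k => if m < k then (1 - q) ^ k * q ^ (n - k) else 0), Finset.card_univ, Fintype.card_fin,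
      binomTail]
    simp_rw [nsmul_eq_mul, mul_ite, mul_zero]
    rw [← Finset.sum_filter]
    refine Finset.sum_congr ?_ fun _ _ => rfl
    ext k
    simp
    omega
  · intro S _ S' _ hne
    refine Set.disjoint_left.2 fun x hx hx' => hne ?_
    rw [← (hmem S x).1 hx, ← (hmem S' x).1 hx']

end BinomialTail

/-! ### Estimates for the distribution function of one coordinate. -/

section CoordLaw

variable {p : ℝ} {n : ℕ}

/-- The distribution function of the absolute value under `coordLaw`. -/
noncomputable def coordCdf (p : ℝ) (n : ℕ) (t : ℝ) : ℝ := (coordLaw p n).real {s | |s| ≤ t}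

theorem coordCdf_nonneg (p : ℝ) (n : ℕ) (t : ℝ) : 0 ≤ coordCdf p n t := measureReal_nonneg

theorem coordCdf_le_one (hp : 0 < p) [NeZero n] (t : ℝ) : coordCdf p n t ≤ 1 := by
  have := isProbabilityMeasure_coordLaw (n := n) hp
  exact measureReal_le_one

theorem coordLaw_abs_le (p : ℝ) (n : ℕ) (t : ℝ) :
    coordLaw p n {s | |s| ≤ t} = ENNReal.ofReal (p / Real.Gamma (1 / n)) *
      ∫⁻ s in Ioc 0 t, ENNReal.ofReal (s ^ (p / n - 1) * Real.exp (-s ^ p)) := by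
  have hm : MeasurableSet {s : ℝ | |s| ≤ t} := measurableSet_le (by fun_prop) measurable_const
  rw [coordLaw, withDensity_apply _ hm, lintegral_const_mul _ (measurable_coordWeight p n),
    coordWeight, setLIntegral_indicator measurableSet_Ioi]
  congr 3
  ext s
  simp only [mem_inter_iff, mem_Ioi, mem_ofPred_eq, mem_Ioc]
  exact ⟨fun h => ⟨h.1, (le_abs_self s).trans h.2⟩, fun h => ⟨h.1, (abs_of_pos h.1).trans_le h.2⟩⟩

theorem ofReal_coordCdf (hp : 0 < p) [NeZero n] (t : ℝ) :
    ENNReal.ofReal (coordCdf p n t) = coordLaw p n {s | |s| ≤ t} := by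
  have := isProbabilityMeasure_coordLaw (n := n) hp
  exact ofReal_measureReal

theorem Gamma_one_add_one_div (n : ℕ) [NeZero n] :
    Real.Gamma (1 + 1 / n) = Real.Gamma (1 / n) / n := by
  have hn : (n : ℝ) ≠ 0 := by exact_mod_cast NeZero.ne n
  rw [add_comm, Real.Gamma_add_one (one_div_ne_zero hn), one_div_mul_eq_div]

/-- Bound exp(-s^p) by 1 in the density and integrate the power; then Γ(1/n)/n = Γ(1+1/n). -/
theorem coordCdf_le (hp : 0 < p) [NeZero n] {t : ℝ} (ht : 0 < t) :
    coordCdf p n t ≤ t ^ (p / n) / Real.Gamma (1 + 1 / n) := by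
  have hG := Gamma_one_div_pos n
  have hn : (0 : ℝ) < n := by exact_mod_cast NeZero.pos n
  have hb : 0 < p / n := by positivity
  have hint : ∫⁻ s in Ioc 0 t, ENNReal.ofReal (s ^ (p / n - 1)) =
      ENNReal.ofReal (t ^ (p / n) / (p / n)) := by
    have h := intervalIntegral.intervalIntegrable_rpow' (a := 0) (b := t) (r := p / n - 1)
      (by linarith)
    rw [← ofReal_integral_eq_lintegral_ofReal h.1, ← intervalIntegral.integral_of_le ht.le,
      integral_rpow (.inl (by linarith)), sub_add_cancel, Real.zero_rpow hb.ne', sub_zero]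
    exact (ae_restrict_iff' measurableSet_Ioc).2 (ae_of_all _ fun s hs =>
      Real.rpow_nonneg hs.1.le _)
  have hG' : 0 < Real.Gamma (1 + 1 / n) := by
    rw [Gamma_one_add_one_div]
    positivity
  rw [← ENNReal.ofReal_le_ofReal_iff (by positivity), ofReal_coordCdf hp, coordLaw_abs_le]
  calc _ ≤ ENNReal.ofReal (p / Real.Gamma (1 / n)) *
        ∫⁻ s in Ioc 0 t, ENNReal.ofReal (s ^ (p / n - 1)) := by
        refine mul_le_mul' le_rfl ?_
        refine setLIntegral_mono' measurableSet_Ioc fun s hs => ENNReal.ofReal_le_ofReal ?_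
        have h1 : 0 ≤ s ^ (p / n - 1) := Real.rpow_nonneg hs.1.le _
        have h2 : Real.exp (-s ^ p) ≤ 1 :=
          Real.exp_le_one_iff.2 (neg_nonpos.2 (Real.rpow_nonneg hs.1.le _))
        exact mul_le_of_le_one_right h1 h2
    _ = _ := by
        rw [hint, ← ENNReal.ofReal_mul (by positivity), Gamma_one_add_one_div]
        congr 1
        field_simp

/-- Substituting s = rt pulls out t^(p/n) and leaves an integral over r in (0, 1] with exp(-(rt)^p),
which is at least exp(-r^p) because t ≤ 1. -/
theorem le_coordCdf (hp : 0 < p) [NeZero n] {t : ℝ} (ht : 0 < t) (ht1 : t ≤ 1) :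
    coordCdf p n 1 * t ^ (p / n) ≤ coordCdf p n t := by
  have key : ∫⁻ s in Ioc 0 t, ENNReal.ofReal (s ^ (p / n - 1) * Real.exp (-s ^ p)) =
      ENNReal.ofReal (t ^ (p / n)) *
        ∫⁻ r in Ioc (0 : ℝ) 1, ENNReal.ofReal (r ^ (p / n - 1) * Real.exp (-(r * t) ^ p)) := by
    have h := lintegral_Ioi_comp_mul_right ht 0 ((Iic t).indicator fun s =>
      ENNReal.ofReal (s ^ (p / n - 1) * Real.exp (-s ^ p)))
    simp only [pow_zero, ENNReal.ofReal_one, one_mul, zero_add, pow_one] at h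
    rw [setLIntegral_indicator measurableSet_Iic, inter_comm, Ioi_inter_Iic] at h
    have hti : ENNReal.ofReal t * ENNReal.ofReal t⁻¹ = 1 := by
      rw [← ENNReal.ofReal_mul ht.le, mul_inv_cancel₀ ht.ne', ENNReal.ofReal_one]
    rw [← one_mul (∫⁻ s in Ioc 0 t, _), ← hti, mul_assoc, ← h,
      ← lintegral_const_mul' _ _ (by finiteness), ← lintegral_const_mul' _ _ (by finiteness),
      ← Ioi_inter_Iic, inter_comm, ← setLIntegral_indicator measurableSet_Iic]
    refine setLIntegral_congr_fun measurableSet_Ioi fun r hr => ?_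
    have hr : 0 < r := hr
    by_cases hr1 : r ≤ 1
    · rw [indicator_of_mem (show r * t ∈ Iic t from mul_le_of_le_one_left ht.le hr1),
        indicator_of_mem (mem_Iic.2 hr1), ← ENNReal.ofReal_mul (by positivity),
        ← ENNReal.ofReal_mul (by positivity), Real.mul_rpow hr.le ht.le,
        Real.rpow_sub_one ht.ne']
      congr 1
      field_simp
    · rw [indicator_of_notMem (fun h => hr1 (le_of_mul_le_mul_right (a := t)
        (by rw [one_mul]; exact h) ht)), indicator_of_notMem (show r ∉ Iic 1 from hr1), mul_zero]
  rw [← ENNReal.ofReal_le_ofReal_iff (coordCdf_nonneg _ _ _),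
    ENNReal.ofReal_mul (coordCdf_nonneg _ _ _), ofReal_coordCdf hp, ofReal_coordCdf hp,
    coordLaw_abs_le, coordLaw_abs_le, key, mul_assoc, mul_comm (∫⁻ s in Ioc (0 : ℝ) 1, _)]
  refine mul_le_mul' le_rfl (mul_le_mul' le_rfl ?_)
  refine setLIntegral_mono' measurableSet_Ioc fun r hr => ENNReal.ofReal_le_ofReal ?_
  have h0 := hr.1
  gcongr
  exact mul_le_of_le_one_right h0.le ht1

theorem lintegral_rpow_mul_exp_Ioi (hp : 0 < p) {t : ℝ} (ht : 0 < t) :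
    ∫⁻ s in Ioi t, ENNReal.ofReal (p * s ^ (p - 1) * Real.exp (-s ^ p)) =
      ENNReal.ofReal (Real.exp (-t ^ p)) := by
  have hd : ∀ s ∈ Ici t, HasDerivAt (fun s : ℝ => -Real.exp (-s ^ p))
      (p * s ^ (p - 1) * Real.exp (-s ^ p)) s := fun s hs => by
    have hs0 : s ≠ 0 := (ht.trans_le hs).ne'
    refine ((Real.hasDerivAt_rpow_const (.inl hs0)).fun_neg.exp.fun_neg).congr_deriv ?_
    ring
  have hpos : ∀ s ∈ Ioi t, 0 ≤ p * s ^ (p - 1) * Real.exp (-s ^ p) := fun s hs => by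
    have : 0 < s := ht.trans hs
    positivity
  have hlim : Tendsto (fun s : ℝ => -Real.exp (-s ^ p)) atTop (𝓝 0) := by
    have := (Real.tendsto_exp_atBot.comp
      (tendsto_neg_atTop_atBot.comp (tendsto_rpow_atTop hp))).neg
    simpa using this
  have hI := integrableOn_Ioi_deriv_of_nonneg' hd hpos hlim
  rw [← ofReal_integral_eq_lintegral_ofReal hI
    ((ae_restrict_iff' measurableSet_Ioi).2 (ae_of_all _ hpos)),
    integral_Ioi_of_hasDerivAt_of_nonneg' hd hpos hlim]
  simp

/-- For s ≥ 1 the power s^(p/n-1) is at most s^(p-1), and p s^(p-1) exp(-s^p) has an elementary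
antiderivative. -/
theorem one_sub_coordCdf_le (hp : 0 < p) [NeZero n] {t : ℝ} (ht : 1 ≤ t) :
    1 - coordCdf p n t ≤ Real.exp (-t ^ p) / Real.Gamma (1 / n) := by
  have := isProbabilityMeasure_coordLaw (n := n) hp
  have hG := Gamma_one_div_pos n
  have hn : (1 : ℝ) ≤ n := by exact_mod_cast NeZero.pos n
  have ht0 : 0 < t := by linarith
  have hm : MeasurableSet {s : ℝ | |s| ≤ t} := measurableSet_le (by fun_prop) measurable_const
  rw [coordCdf, ← probReal_compl_eq_one_sub hm, ← ENNReal.ofReal_le_ofReal_iff (by positivity),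
    ofReal_measureReal, coordLaw, withDensity_apply _ hm.compl,
    lintegral_const_mul _ (measurable_coordWeight p n), coordWeight,
    setLIntegral_indicator measurableSet_Ioi]
  have hset : Ioi (0 : ℝ) ∩ {s | |s| ≤ t}ᶜ = Ioi t := by
    ext s
    simp only [mem_inter_iff, mem_Ioi, mem_compl_iff, mem_ofPred_eq, not_le]
    exact ⟨fun h => by rw [← abs_of_pos h.1]; exact h.2,
      fun h => ⟨ht0.trans h, h.trans_le (le_abs_self s)⟩⟩
  rw [hset]
  calc _ ≤ ENNReal.ofReal (p / Real.Gamma (1 / n)) *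
        ∫⁻ s in Ioi t, ENNReal.ofReal (s ^ (p - 1) * Real.exp (-s ^ p)) := by
        refine mul_le_mul' le_rfl ?_
        refine setLIntegral_mono' measurableSet_Ioi fun s hs => ENNReal.ofReal_le_ofReal ?_
        have hs1 : 1 ≤ s := ht.trans (le_of_lt hs)
        gcongr
        exact div_le_self hp.le hn
    _ = _ := by
        rw [← lintegral_const_mul' _ _ (by finiteness), div_eq_mul_inv _ (Real.Gamma _),
          div_eq_mul_inv _ (Real.Gamma _), ENNReal.ofReal_mul (Real.exp_pos _).le,
          ← lintegral_rpow_mul_exp_Ioi hp ht0, ← lintegral_mul_const' _ _ (by finiteness)]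
        refine setLIntegral_congr_fun measurableSet_Ioi fun s hs => ?_
        have hs0 : 0 < s := ht0.trans hs
        rw [← ENNReal.ofReal_mul (by positivity), ← ENNReal.ofReal_mul (by positivity)]
        congr 1
        ring

/-- By convexity of log Γ, the slope n log Γ(1+1/n) on [1, 1+1/n] is at least the slope on [1/2, 1].
The latter is -log π, since Γ(1/2) = √π and Γ(1) = 1. -/
theorem inv_pi_le_Gamma_pow (n : ℕ) [NeZero n] : Real.pi⁻¹ ≤ Real.Gamma (1 + 1 / n) ^ n := by
  have hn : (0 : ℝ) < n := by exact_mod_cast NeZero.pos n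
  have hn' : (0 : ℝ) < 1 / n := by positivity
  have hG : 0 < Real.Gamma (1 + 1 / n) := Real.Gamma_pos_of_pos (by linarith)
  have h := Real.convexOn_log_Gamma.slope_mono_adjacent (x := 1 / 2) (y := 1) (z := 1 + 1 / n)
    (mem_Ioi.2 (by norm_num)) (mem_Ioi.2 (by linarith)) (by norm_num) (by linarith)
  simp only [Function.comp_apply, Real.Gamma_one, Real.log_one, Real.Gamma_one_half_eq,
    Real.log_sqrt Real.pi_pos.le, add_sub_cancel_left, zero_sub, sub_zero, div_div_eq_mul_div,
    div_one] at h
  rw [← Real.log_le_log_iff (by positivity) (by positivity), Real.log_inv, Real.log_pow]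
  norm_num at h ⊢
  linarith

theorem half_le_Gamma_one_add (hn : 2 ≤ n) : 1 / 2 ≤ Real.Gamma (1 + 1 / n) := by
  have : NeZero n := ⟨by omega⟩
  have hG : 0 < Real.Gamma (1 + 1 / n) := Real.Gamma_pos_of_pos (by positivity)
  by_contra! hc
  have h3 : Real.Gamma (1 + 1 / n) ^ n ≤ (1 / 2 : ℝ) ^ 2 :=
    (pow_le_pow_left₀ hG.le hc.le n).trans
      (pow_le_pow_of_le_one (by norm_num) (by norm_num) hn)
  have h4 : (4 : ℝ)⁻¹ < Real.pi⁻¹ := inv_strictAnti₀ Real.pi_pos Real.pi_lt_four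
  linarith [inv_pi_le_Gamma_pow n]

/-- Bernoulli's inequality gives F(1)^n ≥ 1 - n(1-F(1)). The tail bound at t = 1 and Γ(1/n) =
nΓ(1+1/n) give n(1-F(1)) ≤ e⁻¹/Γ(1+1/n) ≤ 2/e < 3/4. -/
theorem quarter_le_coordCdf_one_pow (hp : 0 < p) (hn : 2 ≤ n) : 1 / 4 ≤ coordCdf p n 1 ^ n := by
  have : NeZero n := ⟨by omega⟩
  have hn0 : (0 : ℝ) < n := by positivity
  have hG : 0 < Real.Gamma (1 + 1 / n) := Real.Gamma_pos_of_pos (by positivity)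
  have h1 : 1 - coordCdf p n 1 ≤ Real.exp (-1) / (n * Real.Gamma (1 + 1 / n)) := by
    have h := one_sub_coordCdf_le (n := n) hp le_rfl
    rwa [Real.one_rpow, show Real.Gamma (1 / n) = n * Real.Gamma (1 + 1 / n) by
      rw [Gamma_one_add_one_div, mul_div_cancel₀ _ hn0.ne']] at h
  have h2 := half_le_Gamma_one_add hn
  have h3 : Real.exp (-1) / Real.Gamma (1 + 1 / n) ≤ 3 / 4 := by
    rw [div_le_iff₀ hG]
    have := Real.exp_neg_one_lt_d9
    linarith
  have h4 := one_add_mul_le_pow (a := coordCdf p n 1 - 1)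
    (by linarith [coordCdf_nonneg p n 1]) n
  rw [add_sub_cancel] at h4
  have h5 : n * (1 - coordCdf p n 1) ≤ Real.exp (-1) / Real.Gamma (1 + 1 / n) := by
    calc n * (1 - coordCdf p n 1) ≤ n * (Real.exp (-1) / (n * Real.Gamma (1 + 1 / n))) := by gcongr
      _ = _ := by field_simp
  linarith

end CoordLaw

/-! ### Two-sided bounds for the average width, and the limit of the order moment. -/

section Bounds

variable {p : ℝ} {n m : ℕ}

/-- The mean of the best `m`-term error of a vector with independent coordinates. -/
noncomputable def meanError (p : ℝ) (n m : ℕ) : ℝ≥0∞ :=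
  ∫⁻ x, ENNReal.ofReal (bestTermError ∞ m x) ∂(Measure.pi fun _ : Fin n => coordLaw p n)

/-- Layer-cake formula: the (m-1)-term error exceeds t exactly when at least m coordinates do. The
hypothesis 1 ≤ m makes m-1 a genuine predecessor. -/
theorem meanError_eq (hp : 0 < p) [NeZero n] (hm : 1 ≤ m) :
    meanError p n (m - 1) =
      ∫⁻ t in Ioi 0, ENNReal.ofReal (binomTail n m (coordCdf p n t)) := by
  have := isProbabilityMeasure_coordLaw (n := n) hp
  rw [meanError, lintegral_eq_lintegral_meas_lt _
    (ae_of_all _ fun x => bestTermError_top_nonneg _ x)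
    (measurable_bestTermError_top _).aemeasurable]
  refine setLIntegral_congr_fun measurableSet_Ioi fun t ht => ?_
  rw [measure_lt_bestTermError_top _ _ _ (le_of_lt ht), Nat.sub_add_cancel hm, coordCdf]

theorem averageWidth_eq (hp : 0 < p) [NeZero n] (m : ℕ) :
    averageWidth p ∞ m (tensorMeasure p (p / n - 1) n) =
      (ENNReal.ofReal (1 / Real.Gamma (1 / p + 1)) * meanError p n m).toReal := by
  rw [averageWidth, integral_eq_lintegral_of_nonneg_ae
    (ae_of_all _ fun x => bestTermError_top_nonneg _ x)
    (measurable_bestTermError_top _).aestronglyMeasurable,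
    lintegral_tensorMeasure hp (measurable_bestTermError_top m)
      fun r hr x => bestTermError_top_smul m hr x, meanError]

/-- The model case with distribution function (κt)^(p/n) on (0, κ⁻¹). Both bounds below compare the
true law with it. -/
theorem lintegral_binomTail_scaled (hp : 0 < p) [NeZero n] (hmn : m ≤ n) {κ : ℝ} (hκ : 0 < κ) :
    ∫⁻ t in Ioo 0 κ⁻¹, ENNReal.ofReal (binomTail n m ((t * κ) ^ (p / n))) =
      ENNReal.ofReal (κ⁻¹ * orderMoment n m (n / p)) := by
  have hn : (0 : ℝ) < n := by exact_mod_cast NeZero.pos n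
  have h := lintegral_Ioi_comp_mul_right hκ 0 ((Iio 1).indicator fun s =>
      ENNReal.ofReal (binomTail n m (s ^ (p / n))))
  simp only [pow_zero, ENNReal.ofReal_one, one_mul, zero_add, pow_one] at h
  rw [setLIntegral_indicator measurableSet_Iio, inter_comm, Ioi_inter_Iio,
    ← one_div_div (n : ℝ) p, lintegral_binomTail_rpow (div_pos hn hp) hmn,
    ← ENNReal.ofReal_mul (by positivity)] at h
  rw [← h, ← Ioi_inter_Iio, inter_comm, ← setLIntegral_indicator measurableSet_Iio]
  congr 1
  ext t
  have hiff : t * κ < 1 ↔ t < κ⁻¹ := by rw [← lt_div_iff₀ hκ, one_div]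
  by_cases ht : t < κ⁻¹
  · rw [indicator_of_mem (mem_Iio.2 ht), indicator_of_mem (mem_Iio.2 (hiff.2 ht)), one_div_div]
  · rw [indicator_of_notMem (show t ∉ Iio κ⁻¹ from ht),
      indicator_of_notMem (show t * κ ∉ Iio 1 from fun h => ht (hiff.1 h))]

theorem le_meanError (hp : 0 < p) [NeZero n] (hm : 1 ≤ m) (hmn : m ≤ n) :
    ENNReal.ofReal (Real.pi⁻¹ ^ (1 / p) * orderMoment n m (n / p)) ≤ meanError p n (m - 1) := by
  have hn : (0 : ℝ) < n := by exact_mod_cast NeZero.pos n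
  have hG : 0 < Real.Gamma (1 + 1 / n) := Real.Gamma_pos_of_pos (by positivity)
  -- Chosen so that κ^(p/n) = 1/Γ(1+1/n), that is, F(t) ≤ (κt)^(p/n). The binomial tail is antitone
  -- in F, so this bounds the integral from below, and the part t ≥ κ⁻¹ is discarded.
  set κ : ℝ := ((Real.Gamma (1 + 1 / n) ^ n) ^ (1 / p))⁻¹ with hκ
  have hκ0 : 0 < κ := by positivity
  have hκp : κ ^ (p / n) = (Real.Gamma (1 + 1 / n))⁻¹ := by
    rw [hκ, Real.inv_rpow (by positivity), ← Real.rpow_mul (by positivity), ← Real.rpow_natCast,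
      ← Real.rpow_mul hG.le, show n * (1 / p * (p / n)) = (1 : ℝ) by field_simp, Real.rpow_one]
  have hmono : AntitoneOn (binomTail n m) (Icc 0 1) := antitoneOn_binomTail hmn
  calc ENNReal.ofReal (Real.pi⁻¹ ^ (1 / p) * orderMoment n m (n / p))
      ≤ ENNReal.ofReal (κ⁻¹ * orderMoment n m (n / p)) := by
        refine ENNReal.ofReal_le_ofReal (mul_le_mul_of_nonneg_right ?_
          (orderMoment_pos hmn (by positivity)).le)
        rw [hκ, inv_inv]
        exact Real.rpow_le_rpow (by positivity) (inv_pi_le_Gamma_pow n) (by positivity)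
    _ = ∫⁻ t in Ioo 0 κ⁻¹, ENNReal.ofReal (binomTail n m ((t * κ) ^ (p / n))) :=
        (lintegral_binomTail_scaled hp hmn hκ0).symm
    _ ≤ ∫⁻ t in Ioo 0 κ⁻¹, ENNReal.ofReal (binomTail n m (coordCdf p n t)) := by
        refine setLIntegral_mono' measurableSet_Ioo fun t ht => ENNReal.ofReal_le_ofReal ?_
        have ht0 := ht.1
        refine hmono ⟨coordCdf_nonneg _ _ _, coordCdf_le_one hp _⟩ ⟨by positivity, ?_⟩ ?_
        · refine Real.rpow_le_one (by positivity) ?_ (by positivity)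
          rw [← le_div_iff₀ hκ0, one_div]
          exact ht.2.le
        · rw [Real.mul_rpow ht0.le hκ0.le, hκp, ← div_eq_mul_inv]
          exact coordCdf_le hp ht0
    _ ≤ ∫⁻ t in Ioi 0, ENNReal.ofReal (binomTail n m (coordCdf p n t)) :=
        lintegral_mono_set Ioo_subset_Ioi_self
    _ = _ := (meanError_eq hp hm).symm

theorem meanError_le (hp : 0 < p) (hn2 : 2 ≤ n) (hm : 1 ≤ m) (hmn : m ≤ n) :
    meanError p n (m - 1) ≤ ENNReal.ofReal (4 ^ (1 / p) * orderMoment n m (n / p) +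
      Real.exp 1 * (1 / p * Real.Gamma (1 / p)) *
        (n.choose m * (Real.exp (-1) / Real.Gamma (1 / n)) ^ m)) := by
  have : NeZero n := ⟨by omega⟩
  have hn : (0 : ℝ) < n := by exact_mod_cast NeZero.pos n
  have hG := Gamma_one_div_pos n
  have hρ := orderMoment_pos hmn (α := n / p) (by positivity)
  have hGp : 0 < Real.Gamma (1 / p) := Real.Gamma_pos_of_pos (by positivity)
  have hF1 := coordCdf_le_one (n := n) hp 1
  have hF := quarter_le_coordCdf_one_pow hp hn2
  have hF0 : 0 < coordCdf p n 1 := by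
    refine lt_of_le_of_ne (coordCdf_nonneg _ _ _) fun h => ?_
    rw [← h, zero_pow (by omega)] at hF
    norm_num at hF
  -- Chosen so that δ^(p/n) = F(1), which makes (δt)^(p/n) ≤ F(t) on (0, 1). Since δ ≤ 1, the model
  -- integral may be enlarged to (0, δ⁻¹).
  set δ : ℝ := (coordCdf p n 1 ^ n) ^ (1 / p) with hδ
  have hδ0 : 0 < δ := by positivity
  have hδ1 : δ ≤ 1 := Real.rpow_le_one (by positivity) (pow_le_one₀ hF0.le hF1) (by positivity)
  have hδp : δ ^ (p / n) = coordCdf p n 1 := by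
    rw [hδ, ← Real.rpow_mul (by positivity), ← Real.rpow_natCast,
      ← Real.rpow_mul hF0.le, show n * (1 / p * (p / n)) = (1 : ℝ) by field_simp, Real.rpow_one]
  have hδinv : δ⁻¹ ≤ 4 ^ (1 / p) := by
    rw [hδ, ← Real.inv_rpow (by positivity)]
    refine Real.rpow_le_rpow (by positivity) ?_ (by positivity)
    rw [inv_le_comm₀ (by positivity) (by norm_num)]
    linarith
  have hmono : AntitoneOn (binomTail n m) (Icc 0 1) := antitoneOn_binomTail hmn
  have hsmall : ∫⁻ t in Ioo 0 1, ENNReal.ofReal (binomTail n m (coordCdf p n t)) ≤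
      ENNReal.ofReal (4 ^ (1 / p) * orderMoment n m (n / p)) := by
    calc _ ≤ ∫⁻ t in Ioo 0 1, ENNReal.ofReal (binomTail n m ((t * δ) ^ (p / n))) := by
          refine setLIntegral_mono' measurableSet_Ioo fun t ht => ENNReal.ofReal_le_ofReal ?_
          have ht0 := ht.1
          refine hmono ⟨by positivity, ?_⟩ ⟨coordCdf_nonneg _ _ _, coordCdf_le_one hp _⟩ ?_
          · exact Real.rpow_le_one (by positivity) (mul_le_one₀ ht.2.le hδ0.le hδ1) (by positivity)
          · rw [Real.mul_rpow ht0.le hδ0.le, hδp, mul_comm]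
            exact le_coordCdf hp ht0 ht.2.le
      _ ≤ ∫⁻ t in Ioo 0 δ⁻¹, ENNReal.ofReal (binomTail n m ((t * δ) ^ (p / n))) :=
          lintegral_mono_set (Ioo_subset_Ioo_right ((one_le_inv₀ hδ0).2 hδ1))
      _ = ENNReal.ofReal (δ⁻¹ * orderMoment n m (n / p)) :=
          lintegral_binomTail_scaled hp hmn hδ0
      _ ≤ _ := ENNReal.ofReal_le_ofReal (by gcongr)
  have hlarge : ∫⁻ t in Ici 1, ENNReal.ofReal (binomTail n m (coordCdf p n t)) ≤
      ENNReal.ofReal (Real.exp 1 * (1 / p * Real.Gamma (1 / p)) *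
        (n.choose m * (Real.exp (-1) / Real.Gamma (1 / n)) ^ m)) := by
    have hexp : ∫⁻ t in Ioi (0 : ℝ), ENNReal.ofReal (Real.exp (-t ^ p)) =
        ENNReal.ofReal (1 / p * Real.Gamma (1 / p)) := by
      simpa using lintegral_rpow_mul_exp hp (q := 0) (by norm_num)
    set c := n.choose m * (Real.exp (-1) / Real.Gamma (1 / n)) ^ m with hc
    have hc0 : 0 ≤ c := by positivity
    calc _ ≤ ∫⁻ t in Ici (1 : ℝ), ENNReal.ofReal (c * Real.exp 1) *
            ENNReal.ofReal (Real.exp (-t ^ p)) := by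
          refine setLIntegral_mono' measurableSet_Ici fun t ht => ?_
          have ht1 : (1 : ℝ) ≤ t := ht
          rw [← ENNReal.ofReal_mul (by positivity)]
          refine ENNReal.ofReal_le_ofReal ?_
          have hF1' := coordCdf_le_one (n := n) hp t
          have hm1 : (1 : ℝ) ≤ m := by exact_mod_cast hm
          have htp : 1 ≤ t ^ p := Real.one_le_rpow ht1 hp.le
          calc binomTail n m (coordCdf p n t)
              ≤ n.choose m * (1 - coordCdf p n t) ^ m :=
                binomTail_le hmn (coordCdf_nonneg _ _ _) hF1'
            _ ≤ n.choose m * (Real.exp (-t ^ p) / Real.Gamma (1 / n)) ^ m := by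
                have := one_sub_coordCdf_le (n := n) hp ht1
                have h0 : 0 ≤ 1 - coordCdf p n t := by linarith
                gcongr
            _ = n.choose m * (Real.exp (-1) / Real.Gamma (1 / n)) ^ m *
                  Real.exp (m * (1 - t ^ p)) := by
                rw [div_pow, div_pow, ← Real.exp_nat_mul, ← Real.exp_nat_mul,
                  show (m : ℝ) * -t ^ p = m * -1 + m * (1 - t ^ p) by ring, Real.exp_add]
                ring
            -- Since m ≥ 1 and t^p ≥ 1, m(1-t^p) ≤ 1-t^p. The remaining integral then no longer
            -- depends on m or n.
            _ ≤ c * Real.exp (1 + -t ^ p) := by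
                rw [← hc]
                gcongr
                nlinarith
            _ = _ := by rw [Real.exp_add]; ring
      _ ≤ ∫⁻ t in Ioi (0 : ℝ), ENNReal.ofReal (c * Real.exp 1) *
            ENNReal.ofReal (Real.exp (-t ^ p)) :=
          lintegral_mono_set fun t ht => zero_lt_one.trans_le (mem_Ici.1 ht)
      _ = _ := by
          rw [lintegral_const_mul' _ _ (by finiteness), hexp, ← ENNReal.ofReal_mul (by positivity)]
          congr 1
          ring
  rw [meanError_eq hp hm, ← Ioo_union_Ici_eq_Ioi zero_lt_one,
    ENNReal.ofReal_add (by positivity) (by positivity)]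
  exact (lintegral_union_le _ _ _).trans (add_le_add hsmall hlarge)

theorem le_averageWidth (hp : 0 < p) (hn2 : 2 ≤ n) (hm : 1 ≤ m) (hmn : m ≤ n) :
    1 / Real.Gamma (1 / p + 1) * Real.pi⁻¹ ^ (1 / p) * orderMoment n m (n / p) ≤
      averageWidth p ∞ (m - 1) (tensorMeasure p (p / n - 1) n) := by
  have : NeZero n := ⟨by omega⟩
  have hG : 0 < Real.Gamma (1 / p + 1) := Real.Gamma_pos_of_pos (by positivity)
  -- The width is a real number obtained by `toReal`, which sends ∞ to 0, so the lower bound needs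
  -- finiteness; the upper bound supplies it.
  have hfin : meanError p n (m - 1) ≠ ∞ :=
    ne_top_of_le_ne_top ENNReal.ofReal_ne_top (meanError_le hp hn2 hm hmn)
  rw [averageWidth_eq hp, ENNReal.toReal_mul, ENNReal.toReal_ofReal (by positivity), mul_assoc]
  gcongr
  exact (ENNReal.ofReal_le_iff_le_toReal hfin).1 (le_meanError hp hm hmn)

theorem averageWidth_le (hp : 0 < p) (hn2 : 2 ≤ n) (hm : 1 ≤ m) (hmn : m ≤ n) :
    averageWidth p ∞ (m - 1) (tensorMeasure p (p / n - 1) n) ≤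
      1 / Real.Gamma (1 / p + 1) * (4 ^ (1 / p) * orderMoment n m (n / p) +
        Real.exp 1 * (1 / p * Real.Gamma (1 / p)) *
          (n.choose m * (Real.exp (-1) / Real.Gamma (1 / n)) ^ m)) := by
  have : NeZero n := ⟨by omega⟩
  have hG : 0 < Real.Gamma (1 / p + 1) := Real.Gamma_pos_of_pos (by positivity)
  have hGp : 0 < Real.Gamma (1 / p) := Real.Gamma_pos_of_pos (by positivity)
  have hGn := Gamma_one_div_pos n
  have hn : (0 : ℝ) < n := by exact_mod_cast NeZero.pos n
  have hρ := orderMoment_pos hmn (α := n / p) (by positivity)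
  rw [averageWidth_eq hp, ENNReal.toReal_mul, ENNReal.toReal_ofReal (by positivity)]
  gcongr
  exact ENNReal.toReal_le_of_le_ofReal (by positivity) (meanError_le hp hn2 hm hmn)

/-- From Γ(1/n) = nΓ(1+1/n) ≥ n/2 and 2/e < 1 the base is at most 1/n, so the left side is at most
1/m!, and x^m/m! ≤ e^x. With x = 1/p+1 this gives the decay (1/p+1)^(-m) required of the limsup. -/
theorem choose_mul_pow_le (hn2 : 2 ≤ n) (m : ℕ) (x : ℝ) (hx : 0 < x) :
    n.choose m * (Real.exp (-1) / Real.Gamma (1 / n)) ^ m ≤ Real.exp x / x ^ m := by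
  have : NeZero n := ⟨by omega⟩
  have hn : (0 : ℝ) < n := by exact_mod_cast NeZero.pos n
  have hG := Gamma_one_div_pos n
  have h1 : Real.exp (-1) / Real.Gamma (1 / n) ≤ 1 / n := by
    have h2 := half_le_Gamma_one_add hn2
    rw [Gamma_one_add_one_div, le_div_iff₀ hn] at h2
    have := Real.exp_neg_one_lt_d9
    rw [div_le_div_iff₀ hG hn]
    nlinarith
  calc (n.choose m : ℝ) * (Real.exp (-1) / Real.Gamma (1 / n)) ^ m
      ≤ (n ^ m / m.factorial) * (1 / n) ^ m := by
        gcongr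
        exact Nat.choose_le_pow_div m n
    _ = (x ^ m / m.factorial) / x ^ m := by
        rw [div_mul_eq_mul_div, ← mul_pow, mul_one_div_cancel hn.ne', one_pow, div_right_comm,
          div_self (by positivity)]
    _ ≤ Real.exp x / x ^ m := by
        gcongr
        exact Real.pow_div_factorial_le_exp x hx.le m

/-- Passing from m to m+1 multiplies the order moment by (n-m)/(n/p+n-m), which tends to 1/(1/p+1).
-/
theorem tendsto_orderMoment (hp : 0 < p) (m : ℕ) :
    Tendsto (fun n : ℕ => orderMoment n m (n / p)) atTop (𝓝 (1 / (1 / p + 1) ^ m)) := by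
  induction m with
  | zero =>
    refine tendsto_const_nhds.congr fun n => ?_
    have h1 : Real.Gamma (n + 1) ≠ 0 := (Real.Gamma_pos_of_pos (by positivity)).ne'
    have h2 : Real.Gamma (n / p + n + 1) ≠ 0 := (Real.Gamma_pos_of_pos (by positivity)).ne'
    simp [orderMoment, h1, h2]
  | succ m ih =>
    have hfac : Tendsto (fun n : ℕ => ((n : ℝ) - m) / (n / p + n - m)) atTop
        (𝓝 (1 / (1 / p + 1))) := by
      have h0 : Tendsto (fun n : ℕ => (m : ℝ) / n) atTop (𝓝 0) :=
        tendsto_const_div_atTop_nhds_zero_nat _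
      have h1 := (h0.const_sub 1).div (h0.const_sub (1 / p + 1)) (by
        rw [sub_zero]; positivity)
      rw [sub_zero, sub_zero] at h1
      refine h1.congr' ?_
      filter_upwards [eventually_gt_atTop 0] with n hn
      have hn' : (n : ℝ) ≠ 0 := by positivity
      simp only [Pi.div_apply]
      rw [← mul_div_mul_right _ _ hn']
      congr 1 <;> field_simp
    rw [show (1 : ℝ) / (1 / p + 1) ^ (m + 1) = 1 / (1 / p + 1) ^ m * (1 / (1 / p + 1)) by
      rw [pow_succ, one_div_mul_one_div]]
    refine (ih.mul hfac).congr' ?_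
    filter_upwards [eventually_gt_atTop m] with n hn
    have hn' : (0 : ℝ) < n - m := by
      have : (m : ℝ) < n := by exact_mod_cast hn
      linarith
    have hn'' : (0 : ℝ) < n / p + n - m := by
      have : (0 : ℝ) ≤ n / p := by positivity
      linarith
    simp only [orderMoment]
    rw [Real.Gamma_add_one hn'.ne', Real.Gamma_add_one hn''.ne']
    push_cast
    rw [show (n : ℝ) - (m + 1) + 1 = n - m by ring,
      show (n : ℝ) / p + n - (m + 1) + 1 = n / p + n - m by ring]
    have h1 := Real.Gamma_pos_of_pos hn'
    have h2 : 0 < Real.Gamma (n / p + n + 1) := Real.Gamma_pos_of_pos (by positivity)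
    generalize Real.Gamma (n / p + n - m) = A at *
    generalize Real.Gamma (n / p + n + 1) = B at *
    generalize (n : ℝ) / p + n - m = C at *
    field_simp

end Bounds

end SparseAverage

/-! ### Choice of the constants and conclusion. -/

theorem theorem17 (p : ℝ) (hp : 0 < p) :
    ∃ C₁ C₂ : ℝ, 0 < C₁ ∧ 0 < C₂ ∧
      (∀ n m : ℕ, 2 ≤ n → 1 ≤ m → m ≤ n →
        C₁ * (Real.Gamma (n + 1) / Real.Gamma (n - m + 1)) *
            (Real.Gamma (n / p + n - m + 1) / Real.Gamma (n / p + n + 1))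
          ≤ SparseAverage.averageWidth p ∞ (m - 1) (SparseAverage.tensorMeasure p (p / n - 1) n) ∧
        SparseAverage.averageWidth p ∞ (m - 1) (SparseAverage.tensorMeasure p (p / n - 1) n)
          ≤ C₂ * (Real.Gamma (n + 1) / Real.Gamma (n - m + 1)) *
            (Real.Gamma (n / p + n - m + 1) / Real.Gamma (n / p + n + 1) +
              1 / (m.factorial : ℝ) * (Real.exp (-1) / Real.Gamma (1 / n)) ^ m)) ∧
      (∀ m : ℕ, 1 ≤ m →
        C₁ / (1 / p + 1) ^ m
          ≤ liminf (fun n : ℕ => SparseAverage.averageWidth p ∞ (m - 1)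
              (SparseAverage.tensorMeasure p (p / n - 1) n)) atTop ∧
        liminf (fun n : ℕ => SparseAverage.averageWidth p ∞ (m - 1)
              (SparseAverage.tensorMeasure p (p / n - 1) n)) atTop
          ≤ limsup (fun n : ℕ => SparseAverage.averageWidth p ∞ (m - 1)
              (SparseAverage.tensorMeasure p (p / n - 1) n)) atTop ∧
        limsup (fun n : ℕ => SparseAverage.averageWidth p ∞ (m - 1)
              (SparseAverage.tensorMeasure p (p / n - 1) n)) atTop
          ≤ C₂ / (1 / p + 1) ^ m) := by
  have hG : 0 < Real.Gamma (1 / p + 1) := Real.Gamma_pos_of_pos (by positivity)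
  have hGp : 0 < Real.Gamma (1 / p) := Real.Gamma_pos_of_pos (by positivity)
  set g := 1 / Real.Gamma (1 / p + 1) with hg
  set K := Real.exp 1 * (1 / p * Real.Gamma (1 / p)) with hK
  have hg0 : 0 < g := by positivity
  have hK0 : 0 < K := by positivity
  have hx : 0 < 1 / p + 1 := by positivity
  have h4 : (0 : ℝ) < 4 ^ (1 / p) := by positivity
  have hE : 1 ≤ Real.exp (1 / p + 1) := Real.one_le_exp hx.le
  have hKE : K ≤ K * Real.exp (1 / p + 1) := le_mul_of_one_le_right hK0.le hE
  -- The factor exp(1/p+1) in C₂ serves only the limsup, where it comes from 1/m! ≤ e^x/x^m at x =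
  -- 1/p+1. For the bound at finite n, g(4^(1/p) + K) would be enough.
  refine ⟨g * Real.pi⁻¹ ^ (1 / p), g * (4 ^ (1 / p) + K * Real.exp (1 / p + 1)), by positivity,
    by positivity, ?_, ?_⟩
  · intro n m hn2 hm hmn
    have : NeZero n := ⟨by omega⟩
    have hn : (0 : ℝ) < n := by exact_mod_cast NeZero.pos n
    have hρ := SparseAverage.orderMoment_pos hmn (α := n / p) (by positivity)
    have hGn := SparseAverage.Gamma_one_div_pos n
    constructor
    · have h := SparseAverage.le_averageWidth hp hn2 hm hmn
      rwa [SparseAverage.orderMoment, ← mul_assoc] at h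
    · refine (SparseAverage.averageWidth_le hp hn2 hm hmn).trans ?_
      have hch : (n.choose m : ℝ) =
          Real.Gamma (n + 1) / Real.Gamma (n - m + 1) * (1 / m.factorial) := by
        rw [Nat.cast_choose ℝ hmn, ← Nat.cast_sub hmn, Real.Gamma_nat_eq_factorial,
          Real.Gamma_nat_eq_factorial]
        have h1 : (m.factorial : ℝ) ≠ 0 := by positivity
        have h2 : ((n - m).factorial : ℝ) ≠ 0 := by positivity
        field_simp
      have hbin : 0 ≤ (n.choose m : ℝ) * (Real.exp (-1) / Real.Gamma (1 / n)) ^ m := by positivity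
      calc _ ≤ g * ((4 ^ (1 / p) + K * Real.exp (1 / p + 1)) *
              SparseAverage.orderMoment n m (n / p) +
              (4 ^ (1 / p) + K * Real.exp (1 / p + 1)) *
                (n.choose m * (Real.exp (-1) / Real.Gamma (1 / n)) ^ m)) := by
            gcongr
            · linarith
            · linarith
        _ = _ := by
            rw [hch, SparseAverage.orderMoment]
            ring
  · intro m hm
    set W := fun n : ℕ => SparseAverage.averageWidth p ∞ (m - 1)
      (SparseAverage.tensorMeasure p (p / n - 1) n) with hW
    have hT := SparseAverage.tendsto_orderMoment hp m
    have hlow : ∀ᶠ n : ℕ in atTop,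
        g * Real.pi⁻¹ ^ (1 / p) * SparseAverage.orderMoment n m (n / p) ≤ W n := by
      filter_upwards [eventually_ge_atTop (max 2 m)] with n hn
      have hn2 : 2 ≤ n := (le_max_left _ _).trans hn
      exact SparseAverage.le_averageWidth hp hn2 hm ((le_max_right _ _).trans hn)
    have hupp : ∀ᶠ n : ℕ in atTop, W n ≤
        g * (4 ^ (1 / p) * SparseAverage.orderMoment n m (n / p) +
          K * (Real.exp (1 / p + 1) / (1 / p + 1) ^ m)) := by
      filter_upwards [eventually_ge_atTop (max 2 m)] with n hn
      have hn2 : 2 ≤ n := (le_max_left _ _).trans hn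
      refine (SparseAverage.averageWidth_le hp hn2 hm ((le_max_right _ _).trans hn)).trans ?_
      gcongr
      exact SparseAverage.choose_mul_pow_le hn2 m _ hx
    have hL := hT.const_mul (g * Real.pi⁻¹ ^ (1 / p))
    have hU := ((hT.const_mul (4 ^ (1 / p))).add_const
      (K * (Real.exp (1 / p + 1) / (1 / p + 1) ^ m))).const_mul g
    have hbU : IsBoundedUnder (· ≤ ·) atTop W := hU.isBoundedUnder_le.mono_le hupp
    have hbL : IsBoundedUnder (· ≥ ·) atTop W := hL.isBoundedUnder_ge.mono_ge hlow
    refine ⟨?_, liminf_le_limsup hbU hbL, ?_⟩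
    · rw [show g * Real.pi⁻¹ ^ (1 / p) / (1 / p + 1) ^ m =
        g * Real.pi⁻¹ ^ (1 / p) * (1 / (1 / p + 1) ^ m) by ring, ← hL.liminf_eq]
      exact liminf_le_liminf hlow hL.isBoundedUnder_ge hbU.isCoboundedUnder_ge
    · rw [show g * (4 ^ (1 / p) + K * Real.exp (1 / p + 1)) / (1 / p + 1) ^ m =
        g * (4 ^ (1 / p) * (1 / (1 / p + 1) ^ m) +
          K * (Real.exp (1 / p + 1) / (1 / p + 1) ^ m)) by ring, ← hU.limsup_eq]
      exact limsup_le_limsup hupp hbL.isCoboundedUnder_le hU.isBoundedUnder_le
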